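/- **Theorem (Canonical instances admit exact recovery).** For $N\ge 1$, $0\le i\le N$ put $B_{N,i}(x)=\binom Ni x^i(1-x)^{N-i}$. Let $p=(p_1,\dots,p_{N+1})$ have pairwise distinct entries in $(0,1)$, let $\alpha=(\alpha_1,\dots,\alpha_{N+1})$ have entries in $(0,1)$ with $\sum_j\alpha_j\le 1$, and let $\widehat w\in\mathbb R^{N+1}$ be the vector induced by this mixture of exactly $T=N+1$ discrete Binomial distributions, i.e. $\widehat w(i)=\sum_{j=1}^{N+1}\alpha_j B_{N,i}(p_j)$ for all $i\in\{0,\dots,N\}$ (in particular, $\widehat w$ may be any discretized probability density induced in this way). 1. The Bernstein–Vandermonde matrix $\mathbf B_N(p)=\big(B_{N,i}(p_j)\big)_{j,i}$ factors as $\mathbf B_N(p)=D_p\cdot\mathbf V(p)\cdot D_{CN}$, where $D_p=\mathrm{diag}\big((1-p_j)^N\big)_{j}$, $\mathbf V(p)=\big((p_j/(1-p_j))^i\big)_{j,i}$ is a Vandermonde matrix and $D_{CN}=\mathrm{diag}\big(\binom Ni\big)_{i}$; and $\alpha$ is the only vector $\beta\in\mathbb R^{N+1}$ with $\widehat w(i)=\sum_{j}\beta_jB_{N,i}(p_j)$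 for all $i$. 2. There are a constant $c\in\mathbb N_+$ and one parallel algorithm that, for all $N\ge1$ and all $p,\alpha,\widehat w$ as above, on input $N$, $p$ and $\widehat w$ outputs exactly the vector $\alpha$ in $O(N\log^2N)$ work and $O(\log^cN)$ depth. Here a parallel algorithm is a finite program, independent of $N$ and of the input, in a first-order language of recursive functions with fork and parallel loops. Its work is the total number of operations and its depth is the length of a longest chain of dependent operations. The unit-cost operations are the exact real operations $+,-,\times,\div,\sqrt{\ }$, array access, and operations on integers, all of which must be at most $(N+2)^k$ for some constant $k$ ($O(\log N)$-bit words). -/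

import Mathlib

open scoped Matrix

namespace MDBD

/-! ### Mixtures of discrete Binomial distributions -/

/-- `B_{N,i}(x) = C(N,i) x^i (1-x)^(N-i)`, the probability that `B(x,N)` equals `i`. -/
noncomputable def bern (N i : ℕ) (x : ℝ) : ℝ :=
  (N.choose i : ℝ) * x ^ i * (1 - x) ^ (N - i)

/-- The parameters `p` and weights `α` of a mixture of `T` discrete Binomial distributions. -/
structure IsMixture {T : ℕ} (p α : Fin T → ℝ) : Prop where
  param_mem : ∀ j, p j ∈ Set.Ioo (0 : ℝ) 1
  distinct : Function.Injective p
  weight_mem : ∀ j, α j ∈ Set.Ioo (0 : ℝ) 1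
  sum_weight_le : ∑ j, α j ≤ 1

/-- The vector `γ` (indexed by `0, …, N`) is induced by the Binomials `B(p j, N)` with
coefficients `α j`. -/
def Induces (N : ℕ) {T : ℕ} (p α : Fin T → ℝ) (γ : Fin (N + 1) → ℝ) : Prop :=
  ∀ i : Fin (N + 1), γ i = ∑ j, α j * bern N i (p j)

/-- The Bernstein-Vandermonde matrix: rows are indexed by the parameters, columns by the degree. -/
noncomputable def bernsteinMatrix (N : ℕ) (p : Fin (N + 1) → ℝ) :
    Matrix (Fin (N + 1)) (Fin (N + 1)) ℝ :=
  Matrix.of fun j i => bern N i (p j)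

/-- The diagonal matrix of the `(1 - p j)^N`. -/
noncomputable def diagParam (N : ℕ) (p : Fin (N + 1) → ℝ) :
    Matrix (Fin (N + 1)) (Fin (N + 1)) ℝ :=
  Matrix.diagonal fun j => (1 - p j) ^ N

/-- The diagonal matrix of the binomial coefficients `C(N,i)`. -/
noncomputable def diagChoose (N : ℕ) : Matrix (Fin (N + 1)) (Fin (N + 1)) ℝ :=
  Matrix.diagonal fun i => (N.choose (i : ℕ) : ℝ)

/-! ### Parallel algorithms: the work-depth model over exact real numbers

A first-order language of recursive functions with a fork (`pair`) and a parallel loop (`tab`), and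
its work-depth semantics. Real arithmetic is exact and has unit cost (real RAM). Integers (used for
control flow and array indices) have unit cost operations, but are confined to a given word bound.
An algorithm is one finite program, the same for all inputs and all input sizes. -/

/-- Run-time values: integers, real numbers, pairs and arrays. -/
inductive Val : Type
  | nat (n : ℕ)
  | real (x : ℝ)
  | pair (a b : Val)
  | arr (l : List Val)

/-- Integer operations (`sub` is truncated at zero). -/
inductive NatOp : Type
  | add | sub | mul | div

/-- The result of an integer operation; `none` is a division by zero. -/
def NatOp.apply : NatOp → ℕ → ℕ → Option ℕ
  | .add, m, n => some (m + n)
  | .sub, m, n => some (m - n)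
  | .mul, m, n => some (m * n)
  | .div, m, n => if n = 0 then none else some (m / n)

/-- Exact real arithmetic. -/
inductive RealOp : Type
  | add | sub | mul | div

open Classical in
/-- The result of a real operation; `none` is a division by zero. -/
noncomputable def RealOp.apply : RealOp → ℝ → ℝ → Option ℝ
  | .add, x, y => some (x + y)
  | .sub, x, y => some (x - y)
  | .mul, x, y => some (x * y)
  | .div, x, y => if y = 0 then none else some (x / y)

/-- Expressions; variables are de Bruijn indices into the environment. -/
inductive Expr : Type
  /-- the variable with the given index -/
  | var (i : ℕ)
  /-- an integer constant -/
  | lit (n : ℕ)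
  | natOp (o : NatOp) (a b : Expr)
  /-- conversion of an integer to a real number -/
  | cast (a : Expr)
  | realOp (o : RealOp) (a b : Expr)
  | sqrt (a : Expr)
  /-- `if a ≤ b then s else t`, for integers `a`, `b` -/
  | ifLe (a b s t : Expr)
  /-- evaluate `a`, bind its value to variable `0`, evaluate `b` -/
  | letIn (a b : Expr)
  /-- evaluate `a` and `b` in parallel -/
  | pair (a b : Expr)
  | fst (a : Expr)
  | snd (a : Expr)
  /-- the array of length `n` whose entry `i` is `body` with `i` bound to variable `0`; all entries
  are evaluated in parallel -/
  | tab (n body : Expr)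
  /-- entry `i` of the array `a` -/
  | get (a i : Expr)
  /-- the length of an array -/
  | len (a : Expr)
  /-- call of the (possibly recursive) function number `f` of the program -/
  | call (f : ℕ) (a : Expr)

/-- A program is a finite list of function bodies; each function has one argument, variable `0`. -/
abbrev Program : Type := List Expr

/-- `Eval P B env e v w d`: in the program `P` with word bound `B` and environment `env`, the
expression `e` terminates without error with the value `v`, performs `w` operations in total
(work), and has a longest chain of dependent operations of length `d` (depth). Every node costs one
unit. The costs of subexpressions add up, except that the depth of a fork or of a parallel loop is
the maximum over its branches. An integer above `B`, an illegal operation or an index out of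
range is an error. -/
inductive Eval (P : Program) (B : ℕ) : List Val → Expr → Val → ℕ → ℕ → Prop
  | var {env : List Val} {i : ℕ} {v : Val} (h : env[i]? = some v) :
      Eval P B env (.var i) v 1 1
  | lit {env : List Val} {n : ℕ} (h : n ≤ B) :
      Eval P B env (.lit n) (.nat n) 1 1
  | natOp {env : List Val} {o : NatOp} {a b : Expr} {m n r w₁ d₁ w₂ d₂ : ℕ}
      (ha : Eval P B env a (.nat m) w₁ d₁) (hb : Eval P B env b (.nat n) w₂ d₂)
      (hr : o.apply m n = some r) (hB : r ≤ B) :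
      Eval P B env (.natOp o a b) (.nat r) (w₁ + w₂ + 1) (d₁ + d₂ + 1)
  | cast {env : List Val} {a : Expr} {n w d : ℕ}
      (ha : Eval P B env a (.nat n) w d) :
      Eval P B env (.cast a) (.real (n : ℝ)) (w + 1) (d + 1)
  | realOp {env : List Val} {o : RealOp} {a b : Expr} {x y z : ℝ} {w₁ d₁ w₂ d₂ : ℕ}
      (ha : Eval P B env a (.real x) w₁ d₁) (hb : Eval P B env b (.real y) w₂ d₂)
      (hz : o.apply x y = some z) :
      Eval P B env (.realOp o a b) (.real z) (w₁ + w₂ + 1) (d₁ + d₂ + 1)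
  | sqrt {env : List Val} {a : Expr} {x : ℝ} {w d : ℕ}
      (ha : Eval P B env a (.real x) w d) (hx : 0 ≤ x) :
      Eval P B env (.sqrt a) (.real (Real.sqrt x)) (w + 1) (d + 1)
  | ifTrue {env : List Val} {a b s t : Expr} {m n : ℕ} {v : Val} {w₁ d₁ w₂ d₂ w₃ d₃ : ℕ}
      (ha : Eval P B env a (.nat m) w₁ d₁) (hb : Eval P B env b (.nat n) w₂ d₂)
      (hmn : m ≤ n) (hs : Eval P B env s v w₃ d₃) :
      Eval P B env (.ifLe a b s t) v (w₁ + w₂ + w₃ + 1) (d₁ + d₂ + d₃ + 1)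
  | ifFalse {env : List Val} {a b s t : Expr} {m n : ℕ} {v : Val} {w₁ d₁ w₂ d₂ w₃ d₃ : ℕ}
      (ha : Eval P B env a (.nat m) w₁ d₁) (hb : Eval P B env b (.nat n) w₂ d₂)
      (hmn : n < m) (ht : Eval P B env t v w₃ d₃) :
      Eval P B env (.ifLe a b s t) v (w₁ + w₂ + w₃ + 1) (d₁ + d₂ + d₃ + 1)
  | letIn {env : List Val} {a b : Expr} {u v : Val} {w₁ d₁ w₂ d₂ : ℕ}
      (ha : Eval P B env a u w₁ d₁) (hb : Eval P B (u :: env) b v w₂ d₂) :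
      Eval P B env (.letIn a b) v (w₁ + w₂ + 1) (d₁ + d₂ + 1)
  | pair {env : List Val} {a b : Expr} {u v : Val} {w₁ d₁ w₂ d₂ : ℕ}
      (ha : Eval P B env a u w₁ d₁) (hb : Eval P B env b v w₂ d₂) :
      Eval P B env (.pair a b) (.pair u v) (w₁ + w₂ + 1) (max d₁ d₂ + 1)
  | fst {env : List Val} {a : Expr} {u v : Val} {w d : ℕ}
      (ha : Eval P B env a (.pair u v) w d) :
      Eval P B env (.fst a) u (w + 1) (d + 1)
  | snd {env : List Val} {a : Expr} {u v : Val} {w d : ℕ}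
      (ha : Eval P B env a (.pair u v) w d) :
      Eval P B env (.snd a) v (w + 1) (d + 1)
  | tab {env : List Val} {a body : Expr} {n w₁ d₁ : ℕ}
      {f : Fin n → Val} {w d : Fin n → ℕ}
      (ha : Eval P B env a (.nat n) w₁ d₁)
      (hbody : ∀ i : Fin n, Eval P B (.nat (i : ℕ) :: env) body (f i) (w i) (d i)) :
      Eval P B env (.tab a body) (.arr (List.ofFn f))
        (w₁ + (∑ i, w i) + 1) (d₁ + Finset.univ.sup d + 1)
  | get {env : List Val} {a b : Expr} {l : List Val} {i : ℕ} {v : Val} {w₁ d₁ w₂ d₂ : ℕ}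
      (ha : Eval P B env a (.arr l) w₁ d₁) (hb : Eval P B env b (.nat i) w₂ d₂)
      (hv : l[i]? = some v) :
      Eval P B env (.get a b) v (w₁ + w₂ + 1) (d₁ + d₂ + 1)
  | len {env : List Val} {a : Expr} {l : List Val} {w d : ℕ}
      (ha : Eval P B env a (.arr l) w d) (hB : l.length ≤ B) :
      Eval P B env (.len a) (.nat l.length) (w + 1) (d + 1)
  | call {env : List Val} {f : ℕ} {a body : Expr} {u v : Val} {w₁ d₁ w₂ d₂ : ℕ}
      (ha : Eval P B env a u w₁ d₁) (hf : P[f]? = some body)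
      (hbody : Eval P B [u] body v w₂ d₂) :
      Eval P B env (.call f a) v (w₁ + w₂ + 1) (d₁ + d₂ + 1)

/-- Run on `input` with word bound `B`, function `0` of the program `P` terminates with `output`
within work `W` and depth `D`. -/
def Program.Computes (P : Program) (B : ℕ) (input output : Val) (W D : ℕ) : Prop :=
  ∃ body w d, P[0]? = some body ∧ Eval P B [input] body output w d ∧ w ≤ W ∧ d ≤ D

/-- A real vector as an array. -/
def encodeVec {n : ℕ} (x : Fin n → ℝ) : Val :=
  .arr (List.ofFn fun i => .real (x i))

end MDBD

/-!
Divide the entries of the induced vector by the binomial coefficients: the results are the moments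
`m i = ∑ l, α l * p l ^ i * (1 - p l) ^ (N - i)`. For each `j`, the coefficient of `X ^ N` in the
product of `∑ i, m i * X ^ i` with `∏ k ≠ j, ((1 - p k) - p k * X)` is a combination of the `α l`
whose coefficients are the products of the linear forms
`(1 - p k) * p l - p k * (1 - p l) = p l - p k` over `k ≠ j`. All terms except that
of `l = j` vanish, and `α j * ∏ k ≠ j, (p j - p k)` is left (`coeff_mul_others`, `coeff_num`). This gives the uniqueness of the weights (`Induces.unique`).
The products `∏ k ≠ j, (p j - p k)` are obtained by the same formula from the power sums of the
`p l` and the linear polynomials `1 - p k * X` (`coeff_den`). The generating function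
of the power sums is `(N + 1 - X * d/dX) Q` divided by `Q = ∏ k, (1 - p k * X)`
(`coeff_eulerPoly_mul`).

The algorithm computes these coefficients for all `j` at once. It builds a binary tree of products
of the linear polynomials (`runs_build`) and descends it (`runs_desc`): at a node with `n` leaves it
holds `n` consecutive coefficients of the generating function times all linear polynomials outside
of that node. Passing to a child multiplies by the polynomial of the sibling, and the coefficients
that the child needs are determined by those that are held. `Q` is inverted by Newton iteration
(`runs_inv`), and the binomial coefficients are read off the product tree of `N` factors `1 + X`.

All this reduces to multiplying two real polynomials with `O(n log n)` operations (`runs_conv`).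
Instead of a Fourier transform with a table of roots of unity, the product is computed modulo
`X ^ n - i` over the complex numbers, by recursion over
`X ^ (2 * h) - s ^ 2 = (X ^ h - s) * (X ^ h + s)` (`dvd_cyc`). The numbers `s` lie on the unit
circle and are not real, hence a square root on the next level is computed without a comparison of
real numbers, which the model does not offer (`IsNonrealUnit`).

The claims about the program are proved in a weakest-precondition calculus (`wp`, `wp_sound`), in
which `simp` evaluates a program symbolically and adds up work and depth.
-/

namespace MDBD

/-! ### A weakest-precondition calculus for the work-depth semantics -/

/-- Evaluation with upper bounds `W`, `D` for work and depth. -/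
def Ev (P : Program) (B : ℕ) (env : List Val) (e : Expr) (v : Val) (W D : ℕ) : Prop :=
  ∃ w d, Eval P B env e v w d ∧ w ≤ W ∧ d ≤ D

/-- Function number `f` of `P`, called on `u`, returns `v` within work `W` and depth `D`. -/
def Runs (P : Program) (B f : ℕ) (u v : Val) (W D : ℕ) : Prop :=
  ∃ body, P[f]? = some body ∧ Ev P B [u] body v W D

/-- The array `f 0, …, f (n - 1)`. -/
def farr (n : ℕ) (f : ℕ → Val) : Val :=
  .arr (List.ofFn fun i : Fin n => f i)

/-- `v` is an integer satisfying `k`. -/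
def AsNat : Val → (ℕ → Prop) → Prop
  | .nat n, k => k n
  | _, _ => False

/-- `v` is a real number satisfying `k`. -/
def AsReal : Val → (ℝ → Prop) → Prop
  | .real x, k => k x
  | _, _ => False

/-- `v` is a pair satisfying `k`. -/
def AsPair : Val → (Val → Val → Prop) → Prop
  | .pair a b, k => k a b
  | _, _ => False

/-- `v` is an array whose entry `i` exists and satisfies `k`. -/
def AsGet : Val → ℕ → (Val → Prop) → Prop
  | .arr l, i, k => ∃ v, l[i]? = some v ∧ k v
  | _, _, _ => False

/-- `v` is an array whose length satisfies `k`. -/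
def AsLen : Val → (ℕ → Prop) → Prop
  | .arr l, k => k l.length
  | _, _ => False

/-- `x` is defined and satisfies `k`. -/
def AsSome {α : Type*} : Option α → (α → Prop) → Prop
  | some x, k => k x
  | none, _ => False

theorem asGet_farr {n i : ℕ} {f : ℕ → Val} {k : Val → Prop} (h : i < n) :
    AsGet (farr n f) i k ↔ k (f i) := by
  simp [AsGet, farr, h]

theorem asLen_farr {n : ℕ} {f : ℕ → Val} {k : ℕ → Prop} :
    AsLen (farr n f) k ↔ k n := by
  simp [AsLen, farr]

theorem farr_congr {n : ℕ} {f g : ℕ → Val} (h : ∀ i < n, f i = g i) : farr n f = farr n g := by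
  simp only [farr]
  congr 2
  funext i
  exact h i i.2

/-- Function number `f` of `P`, called on `u`, returns a value, within some work and depth,
that satisfy `Q`. -/
def CallOk (P : Program) (B f : ℕ) (u : Val) (Q : Val → ℕ → ℕ → Prop) : Prop :=
  ∃ (v : Val) (w d : ℕ), Runs P B f u v w d ∧ Q v w d

theorem Runs.callOk {P : Program} {B f : ℕ} {u v : Val} {w d : ℕ} {Q : Val → ℕ → ℕ → Prop}
    (h : Runs P B f u v w d) (hQ : Q v w d) : CallOk P B f u Q :=
  ⟨v, w, d, h, hQ⟩

/-- The `n` branches described by `R` return the entries of an array; this array and bounds on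
the work and the depth of each branch satisfy `Q`. -/
def TabOk (n : ℕ) (R : ℕ → (Val → ℕ → ℕ → Prop) → Prop) (Q : Val → ℕ → ℕ → Prop) : Prop :=
  ∃ (f : ℕ → Val) (w d : ℕ),
    (∀ i < n, R i fun v w' d' => v = f i ∧ w' ≤ w ∧ d' ≤ d) ∧ Q (farr n f) w d

theorem TabOk.intro {n : ℕ} {R : ℕ → (Val → ℕ → ℕ → Prop) → Prop} {Q : Val → ℕ → ℕ → Prop}
    (f : ℕ → Val) (w d : ℕ) (h : ∀ i < n, R i fun v w' d' => v = f i ∧ w' ≤ w ∧ d' ≤ d)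
    (hQ : Q (farr n f) w d) : TabOk n R Q :=
  ⟨f, w, d, h, hQ⟩

/-- Weakest precondition: `wp P B e env Q` says that `e` evaluates in `env` to some `v`, within some
work `W` and depth `D`, such that `Q v W D`. It is in continuation-passing style, so that
rewriting with its equations reduces a claim on a program to a claim on numbers. Function calls are
left to `CallOk` and parallel loops to `TabOk`; the branches of a parallel loop share one bound on
the work and one on the depth. -/
def wp (P : Program) (B : ℕ) : Expr → List Val → (Val → ℕ → ℕ → Prop) → Prop
  | .var i, env, Q => AsSome env[i]? fun v => Q v 1 1
  | .lit n, _, Q => n ≤ B ∧ Q (.nat n) 1 1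
  | .natOp o a b, env, Q =>
      wp P B a env fun u w₁ d₁ => wp P B b env fun v w₂ d₂ =>
        AsNat u fun m => AsNat v fun n => AsSome (o.apply m n) fun r =>
          r ≤ B ∧ Q (.nat r) (w₁ + w₂ + 1) (d₁ + d₂ + 1)
  | .cast a, env, Q =>
      wp P B a env fun u w d => AsNat u fun n => Q (.real (n : ℝ)) (w + 1) (d + 1)
  | .realOp o a b, env, Q =>
      wp P B a env fun u w₁ d₁ => wp P B b env fun v w₂ d₂ =>
        AsReal u fun x => AsReal v fun y => AsSome (o.apply x y) fun z =>
          Q (.real z) (w₁ + w₂ + 1) (d₁ + d₂ + 1)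
  | .sqrt a, env, Q =>
      wp P B a env fun u w d => AsReal u fun x =>
        0 ≤ x ∧ Q (.real (Real.sqrt x)) (w + 1) (d + 1)
  | .ifLe a b s t, env, Q =>
      wp P B a env fun u w₁ d₁ => wp P B b env fun v w₂ d₂ =>
        AsNat u fun m => AsNat v fun n =>
          (m ≤ n → wp P B s env fun r w₃ d₃ => Q r (w₁ + w₂ + w₃ + 1) (d₁ + d₂ + d₃ + 1)) ∧
          (n < m → wp P B t env fun r w₃ d₃ => Q r (w₁ + w₂ + w₃ + 1) (d₁ + d₂ + d₃ + 1))
  | .letIn a b, env, Q =>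
      wp P B a env fun u w₁ d₁ => wp P B b (u :: env) fun v w₂ d₂ =>
        Q v (w₁ + w₂ + 1) (d₁ + d₂ + 1)
  | .pair a b, env, Q =>
      wp P B a env fun u w₁ d₁ => wp P B b env fun v w₂ d₂ =>
        Q (.pair u v) (w₁ + w₂ + 1) (max d₁ d₂ + 1)
  | .fst a, env, Q =>
      wp P B a env fun u w d => AsPair u fun x _ => Q x (w + 1) (d + 1)
  | .snd a, env, Q =>
      wp P B a env fun u w d => AsPair u fun _ y => Q y (w + 1) (d + 1)
  | .tab a body, env, Q =>
      wp P B a env fun u w₁ d₁ => AsNat u fun n =>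
        TabOk n (fun i R => wp P B body (.nat i :: env) R) fun v w d =>
          Q v (w₁ + n * w + 1) (d₁ + d + 1)
  | .get a b, env, Q =>
      wp P B a env fun u w₁ d₁ => wp P B b env fun v w₂ d₂ =>
        AsNat v fun i => AsGet u i fun r => Q r (w₁ + w₂ + 1) (d₁ + d₂ + 1)
  | .len a, env, Q =>
      wp P B a env fun u w d => AsLen u fun n => n ≤ B ∧ Q (.nat n) (w + 1) (d + 1)
  | .call f a, env, Q =>
      wp P B a env fun u w₁ d₁ => CallOk P B f u fun v w₂ d₂ =>
        Q v (w₁ + w₂ + 1) (d₁ + d₂ + 1)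

theorem AsNat.elim {v : Val} {k : ℕ → Prop} (h : AsNat v k) : ∃ n, v = .nat n ∧ k n := by
  cases v <;> simp_all [AsNat]

theorem AsReal.elim {v : Val} {k : ℝ → Prop} (h : AsReal v k) : ∃ x, v = .real x ∧ k x := by
  cases v <;> simp_all [AsReal]

theorem AsPair.elim {v : Val} {k : Val → Val → Prop} (h : AsPair v k) :
    ∃ x y, v = .pair x y ∧ k x y := by
  cases v <;> simp_all [AsPair]

theorem AsGet.elim {v : Val} {i : ℕ} {k : Val → Prop} (h : AsGet v i k) :
    ∃ l r, v = .arr l ∧ l[i]? = some r ∧ k r := by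
  cases v <;> simp_all [AsGet]

theorem AsLen.elim {v : Val} {k : ℕ → Prop} (h : AsLen v k) :
    ∃ l, v = .arr l ∧ k l.length := by
  cases v <;> simp_all [AsLen]

theorem AsSome.elim {α : Type*} {o : Option α} {k : α → Prop} (h : AsSome o k) :
    ∃ x, o = some x ∧ k x := by
  cases o <;> simp_all [AsSome]

theorem wp_sound {P : Program} {B : ℕ} {e : Expr} {env : List Val} {Q : Val → ℕ → ℕ → Prop}
    (h : wp P B e env Q) : ∃ v W D, Ev P B env e v W D ∧ Q v W D := by
  induction e generalizing env Q with
  | var i =>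
    obtain ⟨v, hv, hQ⟩ := AsSome.elim h
    exact ⟨v, 1, 1, ⟨_, _, .var hv, le_rfl, le_rfl⟩, hQ⟩
  | lit n => exact ⟨_, 1, 1, ⟨_, _, .lit h.1, le_rfl, le_rfl⟩, h.2⟩
  | natOp o a b iha ihb =>
    obtain ⟨u, W₁, D₁, ⟨w₁, d₁, ha, hw₁, hd₁⟩, h⟩ := iha h
    obtain ⟨v, W₂, D₂, ⟨w₂, d₂, hb, hw₂, hd₂⟩, h⟩ := ihb h
    obtain ⟨m, rfl, h⟩ := AsNat.elim h
    obtain ⟨n, rfl, h⟩ := AsNat.elim (v := v) h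
    obtain ⟨r, hr, hB, h⟩ := AsSome.elim (o := o.apply m n) h
    exact ⟨_, _, _, ⟨_, _, .natOp ha hb hr hB, by omega, by omega⟩, h⟩
  | cast a iha =>
    obtain ⟨u, W₁, D₁, ⟨w₁, d₁, ha, hw₁, hd₁⟩, h⟩ := iha h
    obtain ⟨m, rfl, h⟩ := AsNat.elim h
    exact ⟨_, _, _, ⟨_, _, .cast ha, by omega, by omega⟩, h⟩
  | realOp o a b iha ihb =>
    obtain ⟨u, W₁, D₁, ⟨w₁, d₁, ha, hw₁, hd₁⟩, h⟩ := iha h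
    obtain ⟨v, W₂, D₂, ⟨w₂, d₂, hb, hw₂, hd₂⟩, h⟩ := ihb h
    obtain ⟨m, rfl, h⟩ := AsReal.elim h
    obtain ⟨n, rfl, h⟩ := AsReal.elim (v := v) h
    obtain ⟨r, hr, h⟩ := AsSome.elim (o := o.apply m n) h
    exact ⟨_, _, _, ⟨_, _, .realOp ha hb hr, by omega, by omega⟩, h⟩
  | sqrt a iha =>
    obtain ⟨u, W₁, D₁, ⟨w₁, d₁, ha, hw₁, hd₁⟩, h⟩ := iha h
    obtain ⟨m, rfl, hx, h⟩ := AsReal.elim h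
    exact ⟨_, _, _, ⟨_, _, .sqrt ha hx, by omega, by omega⟩, h⟩
  | ifLe a b s t iha ihb ihs iht =>
    obtain ⟨u, W₁, D₁, ⟨w₁, d₁, ha, hw₁, hd₁⟩, h⟩ := iha h
    obtain ⟨v, W₂, D₂, ⟨w₂, d₂, hb, hw₂, hd₂⟩, h⟩ := ihb h
    obtain ⟨m, rfl, h⟩ := AsNat.elim h
    obtain ⟨n, rfl, h⟩ := AsNat.elim (v := v) h
    rcases le_or_gt m n with hmn | hmn
    · obtain ⟨r, W₃, D₃, ⟨w₃, d₃, hs, hw₃, hd₃⟩, h⟩ := ihs (h.1 hmn)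
      exact ⟨_, _, _, ⟨_, _, .ifTrue ha hb hmn hs, by omega, by omega⟩, h⟩
    · obtain ⟨r, W₃, D₃, ⟨w₃, d₃, hs, hw₃, hd₃⟩, h⟩ := iht (h.2 hmn)
      exact ⟨_, _, _, ⟨_, _, .ifFalse ha hb hmn hs, by omega, by omega⟩, h⟩
  | letIn a b iha ihb =>
    obtain ⟨u, W₁, D₁, ⟨w₁, d₁, ha, hw₁, hd₁⟩, h⟩ := iha h
    obtain ⟨v, W₂, D₂, ⟨w₂, d₂, hb, hw₂, hd₂⟩, h⟩ := ihb h
    exact ⟨_, _, _, ⟨_, _, .letIn ha hb, by omega, by omega⟩, h⟩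
  | pair a b iha ihb =>
    obtain ⟨u, W₁, D₁, ⟨w₁, d₁, ha, hw₁, hd₁⟩, h⟩ := iha h
    obtain ⟨v, W₂, D₂, ⟨w₂, d₂, hb, hw₂, hd₂⟩, h⟩ := ihb h
    exact ⟨_, _, _, ⟨_, _, .pair ha hb, by omega, by omega⟩, h⟩
  | fst a iha =>
    obtain ⟨u, W₁, D₁, ⟨w₁, d₁, ha, hw₁, hd₁⟩, h⟩ := iha h
    obtain ⟨x, y, rfl, h⟩ := AsPair.elim h
    exact ⟨_, _, _, ⟨_, _, .fst ha, by omega, by omega⟩, h⟩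
  | snd a iha =>
    obtain ⟨u, W₁, D₁, ⟨w₁, d₁, ha, hw₁, hd₁⟩, h⟩ := iha h
    obtain ⟨x, y, rfl, h⟩ := AsPair.elim h
    exact ⟨_, _, _, ⟨_, _, .snd ha, by omega, by omega⟩, h⟩
  | tab a body iha ihb =>
    obtain ⟨u, W₁, D₁, ⟨w₁, d₁, ha, hw₁, hd₁⟩, h⟩ := iha h
    obtain ⟨n, rfl, f, w, d, hb, hQ⟩ := AsNat.elim h
    have key : ∀ i : Fin n, ∃ w' d', Eval P B (.nat (i : ℕ) :: env) body (f i) w' d' ∧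
        w' ≤ w ∧ d' ≤ d := by
      intro i
      obtain ⟨v, W, D, ⟨w', d', he, hw', hd'⟩, rfl, hW, hD⟩ := ihb (hb i i.2)
      exact ⟨w', d', he, hw'.trans hW, hd'.trans hD⟩
    choose w' d' he hw' hd' using key
    refine ⟨_, _, _, ⟨_, _, .tab ha he, ?_, ?_⟩, hQ⟩
    · have : ∑ i, w' i ≤ n * w := by
        simpa using Finset.sum_le_card_nsmul Finset.univ w' w fun i _ => hw' i
      omega
    · have : Finset.univ.sup d' ≤ d := Finset.sup_le fun i _ => hd' i
      omega
  | get a b iha ihb =>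
    obtain ⟨u, W₁, D₁, ⟨w₁, d₁, ha, hw₁, hd₁⟩, h⟩ := iha h
    obtain ⟨v, W₂, D₂, ⟨w₂, d₂, hb, hw₂, hd₂⟩, h⟩ := ihb h
    obtain ⟨m, rfl, h⟩ := AsNat.elim h
    obtain ⟨l, r, rfl, hr, h⟩ := AsGet.elim (v := u) h
    exact ⟨_, _, _, ⟨_, _, .get ha hb hr, by omega, by omega⟩, h⟩
  | len a iha =>
    obtain ⟨u, W₁, D₁, ⟨w₁, d₁, ha, hw₁, hd₁⟩, h⟩ := iha h
    obtain ⟨l, rfl, hB, h⟩ := AsLen.elim h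
    exact ⟨_, _, _, ⟨_, _, .len ha hB, by omega, by omega⟩, h⟩
  | call f a iha =>
    obtain ⟨u, W₁, D₁, ⟨w₁, d₁, ha, hw₁, hd₁⟩, h⟩ := iha h
    obtain ⟨v, W₂, D₂, ⟨body, hf, w₂, d₂, hb, hw₂, hd₂⟩, h⟩ := h
    exact ⟨_, _, _, ⟨_, _, .call ha hf hb, by omega, by omega⟩, h⟩

theorem Runs.of_wp {P : Program} {B f : ℕ} {u v : Val} {W D : ℕ} {body : Expr}
    (hf : P[f]? = some body)
    (h : wp P B body [u] fun v' W' D' => v' = v ∧ W' ≤ W ∧ D' ≤ D) : Runs P B f u v W D := by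
  obtain ⟨_, W', D', ⟨w, d, he, hw, hd⟩, rfl, hW, hD⟩ := wp_sound h
  exact ⟨body, hf, w, d, he, hw.trans hW, hd.trans hD⟩

/-! The equations of `wp` and of the predicates on values. They are tagged to be applied before the
subterms are simplified, so that `simp` does not enter continuations, and their proofs are not
`rfl`, so that the kernel need not unfold `wp`. -/

section

variable {P : Program} {B : ℕ} {env : List Val} {Q : Val → ℕ → ℕ → Prop}

@[simp ↓] theorem wp_var_zero {v : Val} : wp P B (.var 0) (v :: env) Q ↔ Q v 1 1 := ⟨id, id⟩

@[simp ↓] theorem wp_var_succ {i : ℕ} {v : Val} :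
    wp P B (.var (i + 1)) (v :: env) Q ↔ wp P B (.var i) env Q := ⟨id, id⟩

@[simp ↓] theorem wp_lit {n : ℕ} :
    wp P B (.lit n) env Q ↔
      n ≤ B ∧ Q (.nat n) 1 1 :=
  ⟨id, id⟩

@[simp ↓] theorem wp_natAdd {a b : Expr} :
    wp P B (.natOp .add a b) env Q ↔
      wp P B a env fun u w₁ d₁ => wp P B b env fun v w₂ d₂ =>
        AsNat u fun m => AsNat v fun n =>
          m + n ≤ B ∧ Q (.nat (m + n)) (w₁ + w₂ + 1) (d₁ + d₂ + 1) :=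
  ⟨id, id⟩

@[simp ↓] theorem wp_natSub {a b : Expr} :
    wp P B (.natOp .sub a b) env Q ↔
      wp P B a env fun u w₁ d₁ => wp P B b env fun v w₂ d₂ =>
        AsNat u fun m => AsNat v fun n =>
          m - n ≤ B ∧ Q (.nat (m - n)) (w₁ + w₂ + 1) (d₁ + d₂ + 1) :=
  ⟨id, id⟩

@[simp ↓] theorem wp_half {a : Expr} :
    wp P B (.natOp .div a (.lit 2)) env Q ↔
      wp P B a env fun u w₁ d₁ =>
        2 ≤ B ∧ (AsNat u fun m => m / 2 ≤ B ∧ Q (.nat (m / 2)) (w₁ + 1 + 1) (d₁ + 1 + 1)) :=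
  ⟨id, id⟩

@[simp ↓] theorem wp_realAdd {a b : Expr} :
    wp P B (.realOp .add a b) env Q ↔
      wp P B a env fun u w₁ d₁ => wp P B b env fun v w₂ d₂ =>
        AsReal u fun x => AsReal v fun y =>
          Q (.real (x + y)) (w₁ + w₂ + 1) (d₁ + d₂ + 1) :=
  ⟨id, id⟩

@[simp ↓] theorem wp_realSub {a b : Expr} :
    wp P B (.realOp .sub a b) env Q ↔
      wp P B a env fun u w₁ d₁ => wp P B b env fun v w₂ d₂ =>
        AsReal u fun x => AsReal v fun y =>
          Q (.real (x - y)) (w₁ + w₂ + 1) (d₁ + d₂ + 1) :=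
  ⟨id, id⟩

@[simp ↓] theorem wp_realMul {a b : Expr} :
    wp P B (.realOp .mul a b) env Q ↔
      wp P B a env fun u w₁ d₁ => wp P B b env fun v w₂ d₂ =>
        AsReal u fun x => AsReal v fun y =>
          Q (.real (x * y)) (w₁ + w₂ + 1) (d₁ + d₂ + 1) :=
  ⟨id, id⟩

@[simp ↓] theorem wp_realDiv {a b : Expr} :
    wp P B (.realOp .div a b) env Q ↔
      wp P B a env fun u w₁ d₁ => wp P B b env fun v w₂ d₂ =>
        AsReal u fun x => AsReal v fun y =>
          y ≠ 0 ∧ Q (.real (x / y)) (w₁ + w₂ + 1) (d₁ + d₂ + 1) := by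
  have h : ∀ x y : ℝ, ∀ k : ℝ → Prop, AsSome (RealOp.div.apply x y) k ↔ y ≠ 0 ∧ k (x / y) := by
    intro x y k
    by_cases hy : y = 0 <;> simp [RealOp.apply, hy, AsSome]
  simp only [wp, h]

@[simp ↓] theorem wp_cast {a : Expr} :
    wp P B (.cast a) env Q ↔
      wp P B a env fun u w d => AsNat u fun n => Q (.real (n : ℝ)) (w + 1) (d + 1) :=
  ⟨id, id⟩

@[simp ↓] theorem wp_sqrt {a : Expr} :
    wp P B (.sqrt a) env Q ↔
      wp P B a env fun u w d => AsReal u fun x =>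
        0 ≤ x ∧ Q (.real (Real.sqrt x)) (w + 1) (d + 1) :=
  ⟨id, id⟩

@[simp ↓] theorem wp_ifLe {a : Expr} {b : Expr} {s : Expr} {t : Expr} :
    wp P B (.ifLe a b s t) env Q ↔
      wp P B a env fun u w₁ d₁ => wp P B b env fun v w₂ d₂ =>
        AsNat u fun m => AsNat v fun n =>
          (m ≤ n → wp P B s env fun r w₃ d₃ => Q r (w₁ + w₂ + w₃ + 1) (d₁ + d₂ + d₃ + 1)) ∧
          (n < m → wp P B t env fun r w₃ d₃ => Q r (w₁ + w₂ + w₃ + 1) (d₁ + d₂ + d₃ + 1)) :=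
  ⟨id, id⟩

@[simp ↓] theorem wp_letIn {a : Expr} {b : Expr} :
    wp P B (.letIn a b) env Q ↔
      wp P B a env fun u w₁ d₁ => wp P B b (u :: env) fun v w₂ d₂ =>
        Q v (w₁ + w₂ + 1) (d₁ + d₂ + 1) :=
  ⟨id, id⟩

@[simp ↓] theorem wp_pair {a : Expr} {b : Expr} :
    wp P B (.pair a b) env Q ↔
      wp P B a env fun u w₁ d₁ => wp P B b env fun v w₂ d₂ =>
        Q (.pair u v) (w₁ + w₂ + 1) (max d₁ d₂ + 1) :=
  ⟨id, id⟩

@[simp ↓] theorem wp_fst {a : Expr} :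
    wp P B (.fst a) env Q ↔
      wp P B a env fun u w d => AsPair u fun x _ => Q x (w + 1) (d + 1) :=
  ⟨id, id⟩

@[simp ↓] theorem wp_snd {a : Expr} :
    wp P B (.snd a) env Q ↔
      wp P B a env fun u w d => AsPair u fun _ y => Q y (w + 1) (d + 1) :=
  ⟨id, id⟩

@[simp ↓] theorem wp_tab {a body : Expr} :
    wp P B (.tab a body) env Q ↔
      wp P B a env fun u w₁ d₁ => AsNat u fun n =>
        TabOk n (fun i R => wp P B body (.nat i :: env) R) fun v w d =>
          Q v (w₁ + n * w + 1) (d₁ + d + 1) :=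
  ⟨id, id⟩

@[simp ↓] theorem wp_get {a : Expr} {b : Expr} :
    wp P B (.get a b) env Q ↔
      wp P B a env fun u w₁ d₁ => wp P B b env fun v w₂ d₂ =>
        AsNat v fun i => AsGet u i fun r => Q r (w₁ + w₂ + 1) (d₁ + d₂ + 1) :=
  ⟨id, id⟩

@[simp ↓] theorem wp_len {a : Expr} :
    wp P B (.len a) env Q ↔
      wp P B a env fun u w d => AsLen u fun n => n ≤ B ∧ Q (.nat n) (w + 1) (d + 1) :=
  ⟨id, id⟩

@[simp ↓] theorem wp_call {f : ℕ} {a : Expr} :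
    wp P B (.call f a) env Q ↔
      wp P B a env fun u w₁ d₁ => CallOk P B f u fun v w₂ d₂ =>
        Q v (w₁ + w₂ + 1) (d₁ + d₂ + 1) :=
  ⟨id, id⟩

end

@[simp ↓] theorem asNat_nat {n : ℕ} {k : ℕ → Prop} : AsNat (.nat n) k ↔ k n := ⟨id, id⟩

@[simp ↓] theorem asReal_real {x : ℝ} {k : ℝ → Prop} : AsReal (.real x) k ↔ k x := ⟨id, id⟩

@[simp ↓] theorem asPair_pair {u v : Val} {k : Val → Val → Prop} :
    AsPair (.pair u v) k ↔ k u v := ⟨id, id⟩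

attribute [simp ↓] asGet_farr asLen_farr

section

/-! ### The program -/

local infixl:65 " +ₙ " => Expr.natOp NatOp.add
local infixl:65 " -ₙ " => Expr.natOp NatOp.sub
local infixl:65 " +ᵣ " => Expr.realOp RealOp.add
local infixl:65 " -ᵣ " => Expr.realOp RealOp.sub
local infixl:70 " *ᵣ " => Expr.realOp RealOp.mul
local infixl:70 " /ᵣ " => Expr.realOp RealOp.div

/-- The variable with index `0`. -/
abbrev x₀ : Expr := .var 0

/-- The variable with index `1`. -/
abbrev x₁ : Expr := .var 1

/-- The variable with index `2`. -/
abbrev x₂ : Expr := .var 2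

/-- The variable with index `3`. -/
abbrev x₃ : Expr := .var 3

/-- The variable with index `4`. -/
abbrev x₄ : Expr := .var 4

local notation "ℓ" => Expr.lit

/-- The real number `0`. -/
abbrev r0 : Expr := .cast (.lit 0)

/-- The real number `1`. -/
abbrev r1 : Expr := .cast (.lit 1)

/-- Rounded-down half of an integer. -/
abbrev Expr.half (a : Expr) : Expr := .natOp .div a (ℓ 2)

/-- `(s, (x, y)) ↦ x + s * y` on complex numbers, which are pairs of real numbers. -/
def fmaE : Expr :=
  .pair
    (x₀.snd.fst.fst +ᵣ (x₀.fst.fst *ᵣ x₀.snd.snd.fst -ᵣ x₀.fst.snd *ᵣ x₀.snd.snd.snd))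
    (x₀.snd.fst.snd +ᵣ (x₀.fst.fst *ᵣ x₀.snd.snd.snd +ᵣ x₀.fst.snd *ᵣ x₀.snd.snd.fst))

/-- The square root, with positive real part, of a complex number of modulus `1` other
than `-1`. -/
def csqrtE : Expr :=
  .letIn (.sqrt ((r1 +ᵣ x₀.fst) /ᵣ .cast (ℓ 2))) (.pair x₀ (x₁.snd /ᵣ (x₀ +ᵣ x₀)))

/-- `(s, a)`, with `a` of even length `2 * h`, to the array of the `a i + s * a (i + h)`: the
reduction of a polynomial modulo `X ^ h - s`. -/
def redE : Expr :=
  .letIn x₀.snd.len.half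
    (.tab x₀ (.call 1 (.pair x₂.fst (.pair (x₂.snd.get x₀) (x₂.snd.get (x₀ +ₙ x₁))))))

/-- `(c, (a, b))`, with `a` and `b` of length `n = 2 ^ k`, to `n` times the product of the
polynomials `a` and `b` modulo `X ^ n - c`. -/
def cycE : Expr :=
  .letIn x₀.snd.fst.len.half
    (.ifLe x₀ (ℓ 0)
      (.tab (ℓ 1)
        (.call 1 (.pair (x₂.snd.fst.get (ℓ 0)) (.pair (.pair r0 r0) (x₂.snd.snd.get (ℓ 0))))))
      (.letIn (.call 2 x₁.fst)
        (.letIn (.pair (r0 -ᵣ x₀.fst) (r0 -ᵣ x₀.snd))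
          (.letIn
            (.pair
              (.call 3 (.pair x₁ (.pair (.call 4 (.pair x₁ x₃.snd.fst))
                (.call 4 (.pair x₁ x₃.snd.snd)))))
              (.call 3 (.pair x₀ (.pair (.call 4 (.pair x₀ x₃.snd.fst))
                (.call 4 (.pair x₀ x₃.snd.snd))))))
            (.tab (x₃ +ₙ x₃)
              (.ifLe x₄ x₀
                (.call 1 (.pair (.pair x₃.fst (r0 -ᵣ x₃.snd)) (.pair (.pair r0 r0)
                  (.call 1 (.pair (.pair (r0 -ᵣ r1) r0) (.pair (x₁.fst.get (x₀ -ₙ x₄))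
                    (x₁.snd.get (x₀ -ₙ x₄))))))))
                (.call 1 (.pair (.pair r1 r0) (.pair (x₁.fst.get x₀) (x₁.snd.get x₀))))))))))

/-- `(n, a)`, with `a` a real array, to the complex array of length `n` got by padding with
zeros. -/
def padE : Expr :=
  .tab x₀.fst (.ifLe x₁.snd.len x₀ (.pair r0 r0) (.pair (x₁.snd.get x₀) r0))

/-- `(n, (a, b))`, with `n` a power of two, to the coefficients of the product of the real
polynomials `a` and `b`, if there are at most `n` of them. -/
def convE : Expr :=
  .letIn
    (.call 3 (.pair (.pair r0 r1) (.pair (.call 5 (.pair x₀.fst x₀.snd.fst))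
      (.call 5 (.pair x₀.fst x₀.snd.snd)))))
    (.tab x₁.fst ((x₁.get x₀).fst /ᵣ .cast x₂.fst))

/-- The product tree of an array of linear polynomials, given as pairs of coefficients. -/
def buildE : Expr :=
  .letIn x₀.len.half
    (.ifLe x₀ (ℓ 0)
      (.pair (.tab (ℓ 2) (.ifLe x₀ (ℓ 0) (x₂.get (ℓ 0)).fst (x₂.get (ℓ 0)).snd)) (ℓ 0))
      (.letIn
        (.pair (.call 7 (.tab x₀ (x₂.get x₀))) (.call 7 (.tab x₀ (x₂.get (x₀ +ₙ x₁)))))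
        (.letIn
          (.call 6 (.pair ((x₁ +ₙ x₁) +ₙ (x₁ +ₙ x₁)) (.pair x₀.fst.fst x₀.snd.fst)))
          (.pair (.tab ((x₂ +ₙ x₂) +ₙ ℓ 1) (x₁.get x₀)) x₁))))

/-- `(q, s)` to the upper half of the first coefficients of the product of `q` and `s`. -/
def midE : Expr :=
  .letIn x₀.snd.len.half
    (.letIn (.call 6 (.pair ((x₀ +ₙ x₀) +ₙ (x₀ +ₙ x₀)) x₁))
      (.tab x₁ (x₁.get (x₀ +ₙ x₂))))

/-- `(T, s)` to the values at the leaves of the product tree `T` got by applying `midE` on the way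
down, with the polynomial of the sibling. -/
def descE : Expr :=
  .letIn x₀.snd.len.half
    (.ifLe x₀ (ℓ 0) x₁.snd
      (.letIn
        (.pair
          (.call 8 (.pair x₁.fst.snd.fst (.call 13 (.pair x₁.fst.snd.snd.fst x₁.snd))))
          (.call 8 (.pair x₁.fst.snd.snd (.call 13 (.pair x₁.fst.snd.fst.fst x₁.snd)))))
        (.tab (x₁ +ₙ x₁) (.ifLe x₂ x₀ (x₁.snd.get (x₀ -ₙ x₂)) (x₁.fst.get x₀)))))

/-- `(m, q)`, with `m` a power of two and `q` a polynomial with constant coefficient `1`, to the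
inverse of `q` modulo `X ^ m`, by Newton iteration. -/
def invE : Expr :=
  .letIn x₀.fst.half
    (.ifLe x₀ (ℓ 0) (.tab (ℓ 1) r1)
      (.letIn (.call 9 (.pair x₀ x₁.snd))
        (.letIn
          (.call 6 (.pair ((x₁ +ₙ x₁) +ₙ (x₁ +ₙ x₁)) (.pair (.tab (x₁ +ₙ x₁) (x₃.snd.get x₀)) x₀)))
          (.letIn
            (.call 6 (.pair ((x₂ +ₙ x₂) +ₙ (x₂ +ₙ x₂)) (.pair (.tab (x₂ +ₙ x₂) (x₁.get x₀)) x₁)))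
            (.tab (x₃ +ₙ x₃)
              (.ifLe x₄ x₀ (r0 -ᵣ x₁.get x₀) ((x₃.get x₀ +ᵣ x₃.get x₀) -ᵣ x₁.get x₀)))))))

/-- `(N, m)` to the first of the numbers `m, 2 * m, 4 * m, …` that exceeds `N`. -/
def pow2E : Expr :=
  .ifLe (x₀.fst +ₙ ℓ 1) x₀.snd x₀.snd (.call 10 (.pair x₀.fst (x₀.snd +ₙ x₀.snd)))

/-- `(n, (N, (p, w)))` to the products of the weights with the `∏ (p j - p k)`, `k ≠ j`. -/
def numE : Expr :=
  .letIn (.call 7 (.tab x₀.fst (.ifLe x₁.snd.fst x₀ (.pair r1 r0) (.pair r1 r1))))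
    (.letIn
      (.call 7 (.tab x₁.fst (.ifLe (x₂.snd.fst +ₙ ℓ 1) x₀ (.pair r1 r0)
        (.pair (r1 -ᵣ x₂.snd.snd.fst.get x₀) (r0 -ᵣ x₂.snd.snd.fst.get x₀)))))
      (.call 8 (.pair x₀
        (.tab x₂.fst
          (.ifLe (x₃.fst -ₙ (x₃.snd.fst +ₙ ℓ 1)) x₀
            (x₃.snd.snd.snd.get (x₀ -ₙ (x₃.fst -ₙ (x₃.snd.fst +ₙ ℓ 1))) /ᵣ
              x₂.fst.get (x₀ -ₙ (x₃.fst -ₙ (x₃.snd.fst +ₙ ℓ 1))))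
            r0)))))

/-- `(n, (N, p))` to the products `∏ (p j - p k)`, `k ≠ j`. -/
def denE : Expr :=
  .letIn
    (.call 7 (.tab x₀.fst (.ifLe (x₁.snd.fst +ₙ ℓ 1) x₀ (.pair r1 r0)
      (.pair r1 (r0 -ᵣ x₁.snd.snd.get x₀)))))
    (.letIn
      (.call 6 (.pair (x₁.fst +ₙ x₁.fst)
        (.pair
          (.tab x₁.fst (.ifLe (x₂.snd.fst +ₙ ℓ 1) x₀ r0
            (.cast ((x₂.snd.fst +ₙ ℓ 1) -ₙ x₀) *ᵣ x₁.fst.get x₀)))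
          (.call 9 (.pair x₁.fst x₀.fst)))))
      (.call 8 (.pair x₁
        (.tab x₂.fst
          (.ifLe (x₃.fst -ₙ (x₃.snd.fst +ₙ ℓ 1)) x₀
            (x₁.get (x₀ -ₙ (x₃.fst -ₙ (x₃.snd.fst +ₙ ℓ 1)))) r0)))))

/-- `(N, (p, w))` to the weights of the mixture that induces `w`. -/
def mainE : Expr :=
  .letIn (.call 10 (.pair x₀.fst (ℓ 1)))
    (.letIn
      (.pair (.call 11 (.pair x₀ x₁)) (.call 12 (.pair x₀ (.pair x₁.fst x₁.snd.fst))))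
      (.tab (x₂.fst +ₙ ℓ 1) (x₁.fst.get x₀ /ᵣ x₁.snd.get x₀)))

/-- The whole algorithm. A call `.call f` refers to the entry of this list at position `f`: `1` is
`fmaE`, `2` is `csqrtE`, `3` is `cycE`, `4` is `redE`, `5` is `padE`, `6` is `convE`, `7` is
`buildE`, `8` is `descE`, `9` is `invE`, `10` is `pow2E`, `11` is `numE`, `12` is `denE`, `13` is
`midE`. -/
def prog : Program :=
  [mainE, fmaE, csqrtE, cycE, redE, padE, convE, buildE, descE, invE, pow2E, numE, denE, midE]

end

/-! ### Complex arithmetic and multiplication modulo `X ^ n - c` -/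

/-- A complex number as a pair of real numbers. -/
def cval (z : ℂ) : Val := .pair (.real z.re) (.real z.im)

/-- As for all functions of the program, the constants in the bounds are generous: only the growth
of the bounds matters. -/
theorem runs_fma {B : ℕ} (s x y : ℂ) :
    Runs prog B 1 (.pair (cval s) (.pair (cval x) (cval y))) (cval (x + s * y)) 60 30 := by
  refine Runs.of_wp (body := fmaE) rfl ?_
  simp [fmaE, cval]

/-- The square root, with positive real part, of a complex number of modulus `1` other
than `-1`. -/
noncomputable def csqrt (c : ℂ) : ℂ :=
  ⟨Real.sqrt ((1 + c.re) / 2), c.im / (Real.sqrt ((1 + c.re) / 2) + Real.sqrt ((1 + c.re) / 2))⟩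

/-- The unit circle without its real points. It is closed under `csqrt` and negation, and no
comparison of real numbers is needed to choose the branch of the root. -/
structure IsNonrealUnit (c : ℂ) : Prop where
  norm : c.re ^ 2 + c.im ^ 2 = 1
  im_ne : c.im ≠ 0

theorem IsNonrealUnit.one_add_re_pos {c : ℂ} (h : IsNonrealUnit c) : 0 < 1 + c.re := by
  have := h.norm
  have := sq_pos_of_ne_zero h.im_ne
  nlinarith

theorem IsNonrealUnit.sqrt_pos {c : ℂ} (h : IsNonrealUnit c) :
    0 < Real.sqrt ((1 + c.re) / 2) :=
  Real.sqrt_pos.2 (by linarith [h.one_add_re_pos])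

theorem IsNonrealUnit.csqrt_mul_self {c : ℂ} (h : IsNonrealUnit c) : csqrt c * csqrt c = c := by
  have h1 := h.sqrt_pos
  have h2 : Real.sqrt ((1 + c.re) / 2) ^ 2 = (1 + c.re) / 2 :=
    Real.sq_sqrt (by linarith [h.one_add_re_pos])
  have h3 := h.norm
  apply Complex.ext
  · simp only [csqrt, Complex.mul_re]
    field_simp
    nlinarith
  · simp only [csqrt, Complex.mul_im]
    field_simp

theorem IsNonrealUnit.csqrt {c : ℂ} (h : IsNonrealUnit c) : IsNonrealUnit (csqrt c) := by
  have h1 := h.sqrt_pos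
  have h2 : Real.sqrt ((1 + c.re) / 2) ^ 2 = (1 + c.re) / 2 :=
    Real.sq_sqrt (by linarith [h.one_add_re_pos])
  have h3 := h.norm
  constructor
  · simp only [MDBD.csqrt]
    field_simp
    nlinarith
  · simp only [MDBD.csqrt]
    exact div_ne_zero h.im_ne (by linarith)

theorem IsNonrealUnit.neg {c : ℂ} (h : IsNonrealUnit c) : IsNonrealUnit (-c) := by
  constructor
  · simpa using h.norm
  · simpa using h.im_ne

theorem IsNonrealUnit.mul_conj {c : ℂ} (h : IsNonrealUnit c) :
    c * (starRingEnd ℂ) c = 1 := by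
  rw [Complex.mul_conj, Complex.normSq_apply, ← sq, ← sq, h.norm, Complex.ofReal_one]

theorem runs_csqrt {B : ℕ} (hB : 10 ≤ B) {c : ℂ} (h : IsNonrealUnit c) :
    Runs prog B 2 (cval c) (cval (csqrt c)) 30 30 := by
  refine Runs.of_wp (body := csqrtE) rfl ?_
  have h1 := h.sqrt_pos
  have h3 : 2 ≤ B := by omega
  have h4 : 1 ≤ B := by omega
  have h5 : 0 ≤ (1 + c.re) / 2 := by linarith [h.one_add_re_pos]
  simp only [cval, csqrt]
  generalize hu : √((1 + c.re) / 2) = u at h1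
  simp [csqrtE, h3, h4, h5, hu, h1.ne', -Real.sqrt_div']

/-- The complex array of the `a i`, `i < n`. -/
def carr (n : ℕ) (a : ℕ → ℂ) : Val := farr n fun i => cval (a i)

@[simp ↓] theorem asGet_carr {n i : ℕ} {a : ℕ → ℂ} {k : Val → Prop} (h : i < n) :
    AsGet (carr n a) i k ↔ k (cval (a i)) := asGet_farr h

@[simp ↓] theorem asLen_carr {n : ℕ} {a : ℕ → ℂ} {k : ℕ → Prop} :
    AsLen (carr n a) k ↔ k n := asLen_farr

theorem runs_red {B : ℕ} (h : ℕ) (hB : 2 * h + 10 ≤ B) (s : ℂ) (a : ℕ → ℂ) :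
    Runs prog B 4 (.pair (cval s) (carr (2 * h) a)) (carr h fun i => a i + s * a (i + h))
      (100 * h + 20) 60 := by
  refine Runs.of_wp (body := redE) rfl ?_
  have h3 : 2 ≤ B := by omega
  have h4 : 2 * h ≤ B := by omega
  have h5 : h ≤ B := by omega
  simp [redE, h3, h4, h5]
  refine TabOk.intro _ 90 45 (fun i hi => ?_) ⟨rfl, by omega, by omega⟩
  have h6 : i + h < 2 * h := by omega
  have h7 : i < 2 * h := by omega
  have h8 : i + h ≤ B := by omega
  simp [h6, h7, h8]
  exact (runs_fma _ _ _).callOk ⟨rfl, by omega, by omega⟩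

/-- `2 ^ k` times the coefficients of the product of the polynomials with coefficients `a` and `b`
modulo `X ^ (2 ^ k) - c`, computed by recursion over the factorisation
`X ^ (2 * h) - s ^ 2 = (X ^ h - s) * (X ^ h + s)`. -/
noncomputable def cyc : ℕ → ℂ → (ℕ → ℂ) → (ℕ → ℂ) → ℕ → ℂ
  | 0, _, a, b => fun _ => a 0 * b 0
  | k + 1, c, a, b => fun i =>
    let s := csqrt c
    let u := cyc k s (fun i => a i + s * a (i + 2 ^ k)) (fun i => b i + s * b (i + 2 ^ k))
    let v := cyc k (-s) (fun i => a i + -s * a (i + 2 ^ k)) (fun i => b i + -s * b (i + 2 ^ k))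
    if 2 ^ k ≤ i then (starRingEnd ℂ) s * (u (i - 2 ^ k) - v (i - 2 ^ k)) else u i + v i

set_option maxHeartbeats 1000000 in
theorem runs_cyc {B : ℕ} (k : ℕ) (hB : 2 * 2 ^ k + 10 ≤ B) {c : ℂ} (hc : IsNonrealUnit c)
    (a b : ℕ → ℂ) :
    Runs prog B 3 (.pair (cval c) (.pair (carr (2 ^ k) a) (carr (2 ^ k) b)))
      (carr (2 ^ k) (cyc k c a b)) (1000 * 2 ^ k * (k + 1)) (500 * (k + 1)) := by
  induction k generalizing c a b with
  | zero =>
    refine Runs.of_wp (body := cycE) rfl ?_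
    have h3 : 2 ≤ B := by omega
    have h4 : 1 ≤ B := by omega
    simp [cycE, h3, h4]
    refine TabOk.intro _ 100 60 (fun i hi => ?_) ⟨rfl, by omega, by omega⟩
    have h6 : (Val.real 0).pair (Val.real 0) = cval 0 := rfl
    simp [h6]
    refine (runs_fma _ _ _).callOk ⟨?_, by omega, by omega⟩
    simp [cyc]
  | succ k ih =>
    refine Runs.of_wp (body := cycE) rfl ?_
    have hp : 1 ≤ 2 ^ k := Nat.one_le_two_pow
    have e : 2 ^ (k + 1) = 2 * 2 ^ k := by ring
    simp only [e] at hB ⊢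
    obtain ⟨h, hh⟩ : ∃ h, h = 2 ^ k := ⟨_, rfl⟩
    obtain ⟨u, hu⟩ : ∃ u, u = cyc k (csqrt c) (fun i => a i + csqrt c * a (i + 2 ^ k))
      (fun i => b i + csqrt c * b (i + 2 ^ k)) := ⟨_, rfl⟩
    obtain ⟨v, hv⟩ : ∃ v, v = cyc k (-csqrt c) (fun i => a i + -csqrt c * a (i + 2 ^ k))
      (fun i => b i + -csqrt c * b (i + 2 ^ k)) := ⟨_, rfl⟩
    have cycs : ∀ i, cyc (k + 1) c a b i = if 2 ^ k ≤ i then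
        (starRingEnd ℂ) (csqrt c) * (u (i - 2 ^ k) - v (i - 2 ^ k)) else u i + v i := by
      rw [hu, hv]
      exact fun i => rfl
    simp only [← hh] at *
    have h2 : 2 ≤ B := by omega
    have h4 : 1 ≤ B := by omega
    have h5 : 2 * h ≤ B := by omega
    have h6 : h ≤ B := by omega
    have h7 : h + h ≤ B := by omega
    have h8 : h ≠ 0 := by omega
    have hs := hc.csqrt
    simp [cycE, h2, h5, h6, h8, show 0 < h by omega]
    refine (runs_csqrt (by omega) hc).callOk ?_
    have hneg : ∀ s : ℂ, AsPair (cval s) = fun k => k (.real s.re) (.real s.im) := fun s => rfl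
    have hneg' : ∀ s : ℂ, (Val.real (-s.re)).pair (Val.real (-s.im)) = cval (-s) :=
      fun s => by simp [cval]
    simp [hneg, hneg']
    refine (runs_red h (by omega) _ _).callOk ?_
    refine (runs_red h (by omega) _ _).callOk ?_
    refine (ih (by omega) hs _ _).callOk ?_
    refine (runs_red h (by omega) _ _).callOk ?_
    refine (runs_red h (by omega) _ _).callOk ?_
    refine (ih (by omega) hs.neg _ _).callOk ?_
    rw [← hu, ← hv]
    simp [h7]
    refine TabOk.intro (fun i => cval (cyc (k + 1) c a b i)) 300 150 (fun i hi => ?_) ⟨?_, ?_, ?_⟩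
    · have h6 : (Val.real 0).pair (Val.real 0) = cval 0 := rfl
      have h12 : ∀ s : ℂ, (Val.real s.re).pair (Val.real (-s.im)) = cval ((starRingEnd ℂ) s) :=
        fun s => rfl
      have h13 : (Val.real (-1)).pair (Val.real 0) = cval (-1) := by simp [cval]
      have h14 : (Val.real 1).pair (Val.real 0) = cval 1 := rfl
      simp [h4, h6, h12, h13, h14]
      refine ⟨fun hi' => ?_, fun hi' => ?_⟩
      · have : i - h < h := by omega
        simp [show i ≤ B + h by omega, this]
        refine (runs_fma _ _ _).callOk ?_
        simp
        refine (runs_fma _ _ _).callOk ⟨?_, by omega, by omega⟩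
        rw [cycs, if_pos hi']
        congr 1
        ring
      · simp [hi']
        refine (runs_fma _ _ _).callOk ⟨?_, by omega, by omega⟩
        rw [cycs, if_neg (by omega)]
        congr 1
        ring
    · rw [← two_mul]; rfl
    · nlinarith
    · omega

section

open Polynomial

/-- The polynomial with coefficients `a 0, …, a (n - 1)`. -/
noncomputable def toPoly {R : Type*} [Semiring R] (n : ℕ) (a : ℕ → R) : R[X] :=
  ∑ i ∈ Finset.range n, C (a i) * X ^ i

theorem coeff_toPoly {R : Type*} [Semiring R] (n : ℕ) (a : ℕ → R) (i : ℕ) :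
    (toPoly n a).coeff i = if i < n then a i else 0 := by
  simp [toPoly, Polynomial.coeff_C_mul, Polynomial.coeff_X_pow]

theorem natDegree_toPoly_lt {R : Type*} [Semiring R] {n : ℕ} (hn : 0 < n) (a : ℕ → R) :
    (toPoly n a).natDegree < n := by
  rw [Nat.lt_iff_le_pred hn, Polynomial.natDegree_le_iff_coeff_eq_zero]
  intro i hi
  rw [coeff_toPoly, if_neg (by omega)]

theorem toPoly_coeff {R : Type*} [Semiring R] {n : ℕ} {p : R[X]} (h : p.natDegree < n) :
    toPoly n p.coeff = p := by
  ext i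
  rw [coeff_toPoly]
  split_ifs with hi
  · rfl
  · exact (Polynomial.coeff_eq_zero_of_natDegree_lt (by omega)).symm

theorem toPoly_two_mul {R : Type*} [CommSemiring R] (h : ℕ) (a : ℕ → R) :
    toPoly (2 * h) a = toPoly h a + X ^ h * toPoly h (fun i => a (i + h)) := by
  rw [toPoly, two_mul, Finset.sum_range_add, toPoly, toPoly, Finset.mul_sum]
  congr 1
  refine Finset.sum_congr rfl fun i _ => ?_
  rw [add_comm h i]
  ring

theorem toPoly_add {R : Type*} [CommSemiring R] (n : ℕ) (a b : ℕ → R) :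
    toPoly n (fun i => a i + b i) = toPoly n a + toPoly n b := by
  simp only [toPoly, ← Finset.sum_add_distrib, C_add, add_mul]

theorem toPoly_mul {R : Type*} [CommSemiring R] (n : ℕ) (s : R) (a : ℕ → R) :
    toPoly n (fun i => s * a i) = C s * toPoly n a := by
  simp only [toPoly, Finset.mul_sum, C_mul, mul_assoc]

theorem toPoly_congr {R : Type*} [CommSemiring R] {n : ℕ} {a b : ℕ → R}
    (h : ∀ i < n, a i = b i) : toPoly n a = toPoly n b :=
  Finset.sum_congr rfl fun i hi => by rw [h i (Finset.mem_range.1 hi)]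

/-- `cyc` computes the product of polynomials modulo `X ^ n - c`, up to the factor `n`: both sides
agree modulo the coprime factors `X ^ h - s` and `X ^ h + s`. -/
theorem dvd_cyc (k : ℕ) {c : ℂ} (hc : IsNonrealUnit c) (a b : ℕ → ℂ) :
    X ^ 2 ^ k - C c ∣
      C (2 ^ k : ℂ) * (toPoly (2 ^ k) a * toPoly (2 ^ k) b) - toPoly (2 ^ k) (cyc k c a b) := by
  induction k generalizing c a b with
  | zero => simp [toPoly, cyc]
  | succ k ih =>
    have hs := hc.csqrt
    have hu := ih hs (fun i => a i + csqrt c * a (i + 2 ^ k))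
      (fun i => b i + csqrt c * b (i + 2 ^ k))
    have hv := ih hs.neg (fun i => a i + -csqrt c * a (i + 2 ^ k))
      (fun i => b i + -csqrt c * b (i + 2 ^ k))
    obtain ⟨u, hu'⟩ : ∃ u, u = cyc k (csqrt c) (fun i => a i + csqrt c * a (i + 2 ^ k))
      (fun i => b i + csqrt c * b (i + 2 ^ k)) := ⟨_, rfl⟩
    obtain ⟨v, hv'⟩ : ∃ v, v = cyc k (-csqrt c) (fun i => a i + -csqrt c * a (i + 2 ^ k))
      (fun i => b i + -csqrt c * b (i + 2 ^ k)) := ⟨_, rfl⟩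
    have cycs : ∀ i, cyc (k + 1) c a b i = if 2 ^ k ≤ i then
        (starRingEnd ℂ) (csqrt c) * (u (i - 2 ^ k) - v (i - 2 ^ k)) else u i + v i := by
      rw [hu', hv']
      exact fun i => rfl
    rw [← hu'] at hu
    rw [← hv'] at hv
    have hss := hc.csqrt_mul_self
    have hst := hs.mul_conj
    generalize csqrt c = s at *
    -- `t` is the inverse of `s`, as `s` has modulus one
    generalize (starRingEnd ℂ) s = t at *
    obtain ⟨h, hh⟩ : ∃ h, h = 2 ^ k := ⟨_, rfl⟩
    have e : 2 ^ (k + 1) = 2 * 2 ^ k := by ring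
    have ec : (2 : ℂ) ^ (k + 1) = 2 * 2 ^ k := by ring
    rw [e, ec]
    have hR : toPoly (2 * 2 ^ k) (cyc (k + 1) c a b) =
        (toPoly (2 ^ k) u + toPoly (2 ^ k) v) +
          X ^ 2 ^ k * (C t * (toPoly (2 ^ k) u - toPoly (2 ^ k) v)) := by
      rw [toPoly_two_mul]
      congr 1
      · rw [← toPoly_add]
        exact toPoly_congr fun i hi => by rw [cycs, if_neg (by omega)]
      · congr 1
        have : toPoly (2 ^ k) u - toPoly (2 ^ k) v = toPoly (2 ^ k) fun i => u i - v i := by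
          simp only [sub_eq_add_neg, toPoly_add]
          congr 1
          rw [← neg_one_mul, ← C_1, ← C_neg, ← toPoly_mul]
          simp
        rw [this, ← toPoly_mul]
        exact toPoly_congr fun i hi => by rw [cycs, if_pos (by omega)]; simp
    rw [hR, toPoly_two_mul, toPoly_two_mul]
    simp only [toPoly_add, toPoly_mul] at hu hv
    simp only [← hh] at *
    generalize toPoly h a = A₀ at *
    generalize toPoly h (fun i => a (i + h)) = A₁ at *
    generalize toPoly h b = B₀ at *
    generalize toPoly h (fun i => b (i + h)) = B₁ at *
    generalize toPoly h u = U at *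
    generalize toPoly h v = V at *
    have hst' : C s * C t = (1 : ℂ[X]) := by rw [← C_mul, hst, C_1]
    have hfac : (X ^ (2 * h) - C c : ℂ[X]) = (X ^ h - C s) * (X ^ h - C (-s)) := by
      rw [← hss]
      simp only [C_neg, C_mul]
      ring
    have hcop : IsCoprime (X ^ h - C s : ℂ[X]) (X ^ h - C (-s)) := by
      refine ⟨-C (t / 2), C (t / 2), ?_⟩
      have h2 : C (t / 2) + C (t / 2) = C t := by rw [← C_add, add_halves]
      rw [C_neg]
      linear_combination C s * h2 + hst'
    rw [hfac]
    have h2 : (C (2 * 2 ^ k) : ℂ[X]) = 2 * C (2 ^ k) := by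
      rw [C_mul]
      rfl
    rw [h2]
    -- modulo `X ^ h - s` the claim is that for `U`, and modulo `X ^ h + s` that for `V`
    refine hcop.mul_dvd ?_ ?_
    · obtain ⟨W, hW⟩ := hu
      refine ⟨2 * W - C t * (U - V) + 2 * C (2 ^ k) * (A₁ * (B₀ + X ^ h * B₁)
        + (A₀ + C s * A₁) * B₁), ?_⟩
      linear_combination 2 * hW - (U - V) * hst'
    · obtain ⟨W, hW⟩ := hv
      rw [C_neg] at hW ⊢
      refine ⟨2 * W - C t * (U - V) + 2 * C (2 ^ k) * (A₁ * (B₀ + X ^ h * B₁)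
        + (A₀ - C s * A₁) * B₁), ?_⟩
      linear_combination 2 * hW + (U - V) * hst'

/-- The array of the first `n` coefficients of a real polynomial. -/
noncomputable def parr (n : ℕ) (p : ℝ[X]) : Val := farr n fun i => .real (p.coeff i)

/-- If the degree of the product is small enough, reduction modulo `X ^ n - c` does not change
it. -/
theorem cyc_coeff (k : ℕ) {c : ℂ} (hc : IsNonrealUnit c) {p q : ℝ[X]}
    (h : p.natDegree + q.natDegree < 2 ^ k) {i : ℕ} (hi : i < 2 ^ k) :
    cyc k c (fun i => (p.coeff i : ℂ)) (fun i => (q.coeff i : ℂ)) i =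
      ((2 ^ k * (p * q).coeff i : ℝ) : ℂ) := by
  have hd := dvd_cyc k hc (fun i => (p.coeff i : ℂ)) (fun i => (q.coeff i : ℂ))
  have hmap : ∀ r : ℝ[X], r.natDegree < 2 ^ k →
      toPoly (2 ^ k) (fun i => (r.coeff i : ℂ)) = r.map Complex.ofRealHom := by
    intro r hr
    rw [← toPoly_coeff (n := 2 ^ k) (p := r.map Complex.ofRealHom)
      (natDegree_map_le.trans_lt hr)]
    exact toPoly_congr fun i _ => by simp
  rw [hmap p (by omega), hmap q (by omega), ← Polynomial.map_mul] at hd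
  have hn : 0 < 2 ^ k := by positivity
  have hz := eq_zero_of_dvd_of_natDegree_lt hd ?_
  · have := congrArg (fun r => r.coeff i) hz
    simp only [coeff_sub, coeff_C_mul, coeff_map, coeff_toPoly, if_pos hi, coeff_zero] at this
    rw [← sub_eq_zero.1 this]
    simp
  · rw [natDegree_X_pow_sub_C]
    refine (natDegree_sub_le _ _).trans_lt (max_lt ?_ (natDegree_toPoly_lt hn _))
    refine (natDegree_C_mul_le _ _).trans_lt (natDegree_map_le.trans_lt ?_)
    exact natDegree_mul_le.trans_lt h

@[simp ↓] theorem asGet_parr {n i : ℕ} {p : ℝ[X]} {k : Val → Prop} (h : i < n) :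
    AsGet (parr n p) i k ↔ k (.real (p.coeff i)) := asGet_farr h

@[simp ↓] theorem asLen_parr {n : ℕ} {p : ℝ[X]} {k : ℕ → Prop} :
    AsLen (parr n p) k ↔ k n := asLen_farr

theorem runs_pad {B l n : ℕ} {p : ℝ[X]} (hl : l ≤ B) (hp : p.natDegree < l) :
    Runs prog B 5 (.pair (.nat n) (parr l p)) (carr n fun i => (p.coeff i : ℂ))
      (50 * n + 50) 50 := by
  refine Runs.of_wp (body := padE) rfl ?_
  simp [padE]
  refine TabOk.intro (fun i => cval (p.coeff i : ℂ)) 40 40 (fun i hi => ?_)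
    ⟨rfl, by omega, by omega⟩
  simp [hl]
  refine ⟨fun h => ?_, fun h => ?_⟩
  · rw [coeff_eq_zero_of_natDegree_lt (by omega)]
    simp [cval]
  · simp [h, cval]

theorem isNonrealUnit_I : IsNonrealUnit Complex.I := ⟨by simp, by simp⟩

theorem runs_conv {B k la lb : ℕ} {p q : ℝ[X]} (hB : 2 * 2 ^ k + 10 ≤ B)
    (hp : p.natDegree < la) (hq : q.natDegree < lb) (hl : la + lb ≤ 2 ^ k + 1) :
    Runs prog B 6 (.pair (.nat (2 ^ k)) (.pair (parr la p) (parr lb q))) (parr (2 ^ k) (p * q))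
      (2000 * 2 ^ k * (k + 1)) (1000 * (k + 1)) := by
  refine Runs.of_wp (body := convE) rfl ?_
  have hn : 0 < 2 ^ k := by positivity
  have h1 : 1 ≤ B := by omega
  have h2 : (Val.real 0).pair (Val.real 1) = cval Complex.I := by simp [cval]
  simp [convE, h1, h2]
  refine (runs_pad (by omega) hp).callOk ?_
  refine (runs_pad (by omega) hq).callOk ?_
  refine (runs_cyc k hB isNonrealUnit_I _ _).callOk ?_
  simp
  refine TabOk.intro (fun i => .real ((p * q).coeff i)) 40 40 (fun i hi => ?_)
    ⟨rfl, ?_, ?_⟩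
  · simp [hi, cval]
    rw [cyc_coeff k isNonrealUnit_I (by omega) hi, Complex.ofReal_re]
    field_simp
  · nlinarith
  · omega

/-! ### The product tree -/

/-- The product of the first `2 ^ k` leaves. -/
noncomputable def nodePoly (k : ℕ) (lv : ℕ → ℝ[X]) : ℝ[X] := ∏ i ∈ Finset.range (2 ^ k), lv i

theorem nodePoly_succ (k : ℕ) (lv : ℕ → ℝ[X]) :
    nodePoly (k + 1) lv = nodePoly k lv * nodePoly k (fun i => lv (i + 2 ^ k)) := by
  rw [nodePoly, pow_succ, mul_two, Finset.prod_range_add, nodePoly, nodePoly]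
  simp only [add_comm]

theorem natDegree_nodePoly_le (k : ℕ) {lv : ℕ → ℝ[X]} (h : ∀ i, (lv i).natDegree ≤ 1) :
    (nodePoly k lv).natDegree ≤ 2 ^ k := by
  refine (natDegree_prod_le _ _).trans ?_
  simpa using Finset.sum_le_card_nsmul (Finset.range (2 ^ k)) _ 1 fun i _ => h i

/-- The two subtrees of the product tree of the first `2 ^ k` leaves. -/
noncomputable def subtrees : ℕ → (ℕ → ℝ[X]) → Val
  | 0, _ => .nat 0
  | k + 1, lv =>
    .pair (.pair (parr (2 ^ k + 1) (nodePoly k lv)) (subtrees k lv))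
      (.pair (parr (2 ^ k + 1) (nodePoly k fun i => lv (i + 2 ^ k)))
        (subtrees k fun i => lv (i + 2 ^ k)))

/-- The product tree of the first `2 ^ k` leaves: each node holds the product of its leaves. -/
noncomputable def tree (k : ℕ) (lv : ℕ → ℝ[X]) : Val :=
  .pair (parr (2 ^ k + 1) (nodePoly k lv)) (subtrees k lv)

/-- The array of the first `n` leaves, each given by its two coefficients. -/
noncomputable def larr (n : ℕ) (lv : ℕ → ℝ[X]) : Val :=
  farr n fun i => .pair (.real ((lv i).coeff 0)) (.real ((lv i).coeff 1))

@[simp ↓] theorem asGet_larr {n i : ℕ} {lv : ℕ → ℝ[X]} {k : Val → Prop} (h : i < n) :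
    AsGet (larr n lv) i k ↔ k (.pair (.real ((lv i).coeff 0)) (.real ((lv i).coeff 1))) :=
  asGet_farr h

@[simp ↓] theorem asLen_larr {n : ℕ} {lv : ℕ → ℝ[X]} {k : ℕ → Prop} :
    AsLen (larr n lv) k ↔ k n := asLen_farr

set_option maxHeartbeats 1000000 in
theorem runs_build {B : ℕ} (k : ℕ) (hB : 4 * 2 ^ k + 10 ≤ B) (lv : ℕ → ℝ[X])
    (hlv : ∀ i, (lv i).natDegree ≤ 1) :
    Runs prog B 7 (larr (2 ^ k) lv) (tree k lv) (20000 * 2 ^ k * (k + 1) ^ 2)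
      (5000 * (k + 1) ^ 2) := by
  induction k generalizing lv with
  | zero =>
    refine Runs.of_wp (body := buildE) rfl ?_
    have h1 : 1 ≤ B := by omega
    have h2 : 2 ≤ B := by omega
    simp [buildE, h1, h2]
    refine TabOk.intro (fun i => .real ((lv 0).coeff i)) 40 40 (fun i hi => ?_) ?_
    · simp
      refine ⟨fun h => ?_, fun h => ?_⟩
      · rw [h]
      · rw [show i = 1 by omega]
    · simp [tree, nodePoly, subtrees, parr]
  | succ k ih =>
    refine Runs.of_wp (body := buildE) rfl ?_
    have hpow : 2 ^ (k + 1) = 2 * 2 ^ k := by ring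
    have hpow2 : 2 ^ k + 2 ^ k + (2 ^ k + 2 ^ k) = 2 ^ (k + 2) := by ring
    have hp : 1 ≤ 2 ^ k := Nat.one_le_two_pow
    have hconv := runs_conv (B := B) (k := k + 2) (la := 2 ^ k + 1) (lb := 2 ^ k + 1)
      (p := nodePoly k lv) (q := nodePoly k fun i => lv (i + 2 ^ k))
      (by omega) (Nat.lt_succ_of_le (natDegree_nodePoly_le k hlv))
      (Nat.lt_succ_of_le (natDegree_nodePoly_le k fun i => hlv _)) (by omega)
    rw [← nodePoly_succ, ← hpow2] at hconv
    have hih1 := ih (by omega) lv hlv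
    have hih2 := ih (by omega) (fun i => lv (i + 2 ^ k)) fun i => hlv _
    have htree : tree (k + 1) lv = .pair (parr (2 * 2 ^ k + 1) (nodePoly (k + 1) lv))
        (.pair (tree k lv) (tree k fun i => lv (i + 2 ^ k))) := by
      rw [tree, subtrees, hpow]
      rfl
    have ht1 : ∀ lv, tree k lv = .pair (parr (2 ^ k + 1) (nodePoly k lv)) (subtrees k lv) :=
      fun _ => rfl
    rw [htree, hpow]
    rw [ht1] at hih1 hih2 ⊢
    rw [ht1]
    generalize nodePoly (k + 1) lv = q at *
    generalize 2 ^ k = h at *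
    have h1 : 1 ≤ B := by omega
    have h2 : 2 ≤ B := by omega
    have h3 : 2 * h ≤ B := by omega
    have h4 : h ≤ B := by omega
    have h5 : h + h ≤ B := by omega
    have h6 : h + h + (h + h) ≤ B := by omega
    have h7 : h + h + 1 ≤ B := by omega
    simp [buildE, h1, h2, h3, h4, h5, h6, h7, show 0 < h by omega, show h ≠ 0 by omega]
    refine TabOk.intro (fun i => .pair (.real ((lv i).coeff 0)) (.real ((lv i).coeff 1))) 10 10
      (fun i hi => ?_) ?_
    · simp [show i < 2 * h by omega]
    refine hih1.callOk ?_
    refine TabOk.intro (fun i => .pair (.real ((lv (i + h)).coeff 0))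
      (.real ((lv (i + h)).coeff 1))) 10 10 (fun i hi => ?_) ?_
    · simp [show i + h < 2 * h by omega, show i + h ≤ B by omega]
    refine hih2.callOk ?_
    simp
    refine hconv.callOk ?_
    refine TabOk.intro (fun i => .real (q.coeff i)) 10 10 (fun i hi => ?_) ⟨?_, ?_, ?_⟩
    · simp [show i < h + h + (h + h) by omega]
    · rw [← two_mul]
      rfl
    · nlinarith
    · have : max (5000 * (k + 1) ^ 2) (5000 * (k + 1) ^ 2) = 5000 * (k + 1) ^ 2 := max_self _
      have h8 : 5000 * (k + 1 + 1) ^ 2 = 5000 * (k + 1) ^ 2 + 10000 * k + 15000 := by ring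
      push_cast
      rw [h8]
      generalize 5000 * (k + 1) ^ 2 = d at *
      omega

/-! ### Descending the product tree -/

/-- The array of `n` consecutive coefficients of `G`, from index `off` on. -/
noncomputable def sarr (n : ℕ) (G : ℝ[X]) (off : ℕ) : Val :=
  farr n fun i => .real (G.coeff (off + i))

theorem sarr_eq_parr (n : ℕ) (G : ℝ[X]) (off : ℕ) :
    sarr n G off = parr n (toPoly n fun i => G.coeff (off + i)) :=
  farr_congr fun i hi => by rw [coeff_toPoly, if_pos hi]

@[simp ↓] theorem asGet_sarr {n i off : ℕ} {G : ℝ[X]} {k : Val → Prop} (h : i < n) :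
    AsGet (sarr n G off) i k ↔ k (.real (G.coeff (off + i))) := asGet_farr h

@[simp ↓] theorem asLen_sarr {n off : ℕ} {G : ℝ[X]} {k : ℕ → Prop} :
    AsLen (sarr n G off) k ↔ k n := asLen_farr

theorem coeff_mul_of_natDegree_le {q G : ℝ[X]} {h m : ℕ} (hq : q.natDegree ≤ h) (hm : h ≤ m) :
    (q * G).coeff m = ∑ i ∈ Finset.range (h + 1), q.coeff i * G.coeff (m - i) := by
  rw [coeff_mul, Finset.Nat.sum_antidiagonal_eq_sum_range_succ_mk]
  symm
  refine Finset.sum_subset (fun i hi => ?_) fun i _ hi => ?_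
  · simp only [Finset.mem_range] at hi ⊢
    omega
  · simp only [Finset.mem_range] at hi
    rw [coeff_eq_zero_of_natDegree_lt (by omega), zero_mul]

/-- The upper half of the coefficients of `q * G` in a window is determined by the
coefficients of `G` in that window. -/
theorem coeff_mul_toPoly {q G : ℝ[X]} {h i off : ℕ} (hq : q.natDegree ≤ h) (hi : i < h) :
    (q * toPoly (2 * h) fun i => G.coeff (off + i)).coeff (i + h) =
      (q * G).coeff (off + h + i) := by
  rw [coeff_mul_of_natDegree_le hq (by omega), coeff_mul_of_natDegree_le hq (by omega)]
  refine Finset.sum_congr rfl fun j hj => ?_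
  simp only [Finset.mem_range] at hj
  rw [coeff_toPoly, if_pos (by omega)]
  congr 2
  omega

theorem runs_mid {B k off : ℕ} {q G : ℝ[X]} (hB : 8 * 2 ^ k + 10 ≤ B) (hq : q.natDegree ≤ 2 ^ k) :
    Runs prog B 13 (.pair (parr (2 ^ k + 1) q) (sarr (2 * 2 ^ k) G off))
      (sarr (2 ^ k) (q * G) (off + 2 ^ k)) (10000 * 2 ^ k * (k + 3)) (1100 * (k + 3)) := by
  refine Runs.of_wp (body := midE) rfl ?_
  have hpow2 : 2 ^ k + 2 ^ k + (2 ^ k + 2 ^ k) = 2 ^ (k + 2) := by ring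
  have hp : 1 ≤ 2 ^ k := Nat.one_le_two_pow
  have hconv := runs_conv (B := B) (k := k + 2) (la := 2 ^ k + 1) (lb := 2 * 2 ^ k)
    (p := q) (q := toPoly (2 * 2 ^ k) fun i => G.coeff (off + i))
    (by omega) (by omega) (natDegree_toPoly_lt (by omega) _) (by omega)
  rw [← hpow2, ← sarr_eq_parr] at hconv
  have hcoeff : ∀ i < 2 ^ k, _ := fun i hi => coeff_mul_toPoly (G := G) (off := off) hq hi
  generalize 2 ^ k = h at *
  have h2 : 2 ≤ B := by omega
  have h3 : 2 * h ≤ B := by omega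
  have h4 : h ≤ B := by omega
  have h5 : h + h ≤ B := by omega
  have h6 : h + h + (h + h) ≤ B := by omega
  simp [midE, h2, h3, h4, h5, h6]
  refine hconv.callOk ?_
  refine TabOk.intro (fun i => .real ((q * G).coeff (off + h + i))) 10 10 (fun i hi => ?_)
    ⟨rfl, ?_, ?_⟩
  · simp [show i + h < h + h + (h + h) by omega, show i + h ≤ B by omega, hcoeff i hi]
  · nlinarith
  · push_cast
    omega

/-- The product of the first `n` leaves except number `j`. -/
noncomputable def others (n j : ℕ) (lv : ℕ → ℝ[X]) : ℝ[X] :=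
  ∏ i ∈ Finset.range n, if i = j then 1 else lv i

theorem others_left {k j : ℕ} (hj : j < 2 ^ k) (lv : ℕ → ℝ[X]) :
    others (2 * 2 ^ k) j lv = others (2 ^ k) j lv * nodePoly k (fun i => lv (i + 2 ^ k)) := by
  rw [others, two_mul, Finset.prod_range_add, others, nodePoly]
  congr 1
  refine Finset.prod_congr rfl fun i _ => ?_
  rw [if_neg (by omega), add_comm]

theorem others_right {k j : ℕ} (hj : 2 ^ k ≤ j) (lv : ℕ → ℝ[X]) :
    others (2 * 2 ^ k) j lv =
      others (2 ^ k) (j - 2 ^ k) (fun i => lv (i + 2 ^ k)) * nodePoly k lv := by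
  rw [others, two_mul, Finset.prod_range_add, others, nodePoly, mul_comm]
  congr 1
  · refine Finset.prod_congr rfl fun i _ => ?_
    rw [add_comm]
    exact if_congr (by omega) rfl rfl
  · refine Finset.prod_congr rfl fun i hi => ?_
    rw [if_neg]
    have := Finset.mem_range.1 hi
    omega

/-- The array, indexed by the leaves `j`, of the coefficients of index `m` of `G` times the product
of the leaves other than `j`. -/
noncomputable def oarr (n : ℕ) (lv : ℕ → ℝ[X]) (G : ℝ[X]) (m : ℕ) : Val :=
  farr n fun j => .real ((G * others n j lv).coeff m)

@[simp ↓] theorem asGet_oarr {n j m : ℕ} {lv : ℕ → ℝ[X]} {G : ℝ[X]} {k : Val → Prop} (h : j < n) :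
    AsGet (oarr n lv G m) j k ↔ k (.real ((G * others n j lv).coeff m)) := asGet_farr h

set_option maxHeartbeats 1000000 in
/-- The descent, with the invariant that at each node, the array holds consecutive
coefficients of `G` times the product of the leaves outside of that node. -/
theorem runs_desc {B : ℕ} (k off : ℕ) (hB : 4 * 2 ^ k + 10 ≤ B) (lv : ℕ → ℝ[X])
    (hlv : ∀ i, (lv i).natDegree ≤ 1) (G : ℝ[X]) :
    Runs prog B 8 (.pair (tree k lv) (sarr (2 ^ k) G off))
      (oarr (2 ^ k) lv G (off + 2 ^ k - 1)) (30000 * 2 ^ k * (k + 1) ^ 2)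
      (10000 * (k + 1) ^ 2) := by
  induction k generalizing lv G off with
  | zero =>
    refine Runs.of_wp (body := descE) rfl ?_
    have h1 : 1 ≤ B := by omega
    have h2 : 2 ≤ B := by omega
    simp [descE, h1, h2]
    refine farr_congr fun i hi => ?_
    rw [show i = 0 by omega]
    simp [others]
  | succ k ih =>
    refine Runs.of_wp (body := descE) rfl ?_
    have hpow : 2 ^ (k + 1) = 2 * 2 ^ k := by ring
    have hp : 1 ≤ 2 ^ k := Nat.one_le_two_pow
    have hm1 := runs_mid (B := B) (off := off) (G := G) (by omega)
      (natDegree_nodePoly_le k (lv := fun i => lv (i + 2 ^ k)) fun i => hlv _)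
    have hm2 := runs_mid (B := B) (off := off) (G := G) (by omega) (natDegree_nodePoly_le k hlv)
    have hih1 := ih (off + 2 ^ k) (by omega) lv hlv (nodePoly k (fun i => lv (i + 2 ^ k)) * G)
    have hih2 := ih (off + 2 ^ k) (by omega) (fun i => lv (i + 2 ^ k)) (fun i => hlv _)
      (nodePoly k lv * G)
    have hl : ∀ j < 2 ^ k, _ := fun j hj => others_left hj lv
    have hr : ∀ j, 2 ^ k ≤ j → _ := fun j hj => others_right hj lv
    have hoff : off + 2 ^ k + 2 ^ k - 1 = off + 2 * 2 ^ k - 1 := by omega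
    rw [hoff] at hih1 hih2
    rw [hpow]
    simp only [tree, subtrees] at hih1 hih2 ⊢
    generalize nodePoly k (fun i => lv (i + 2 ^ k)) = qR at *
    generalize nodePoly k lv = qL at *
    generalize 2 ^ k = h at *
    generalize off + 2 * h - 1 = m at *
    have h1 : 1 ≤ B := by omega
    have h2 : 2 ≤ B := by omega
    have h3 : 2 * h ≤ B := by omega
    have h4 : h ≤ B := by omega
    have h5 : h + h ≤ B := by omega
    simp [descE, h2, h3, h4, h5, show 0 < h by omega, show h ≠ 0 by omega]
    refine hm1.callOk ?_
    refine hih1.callOk ?_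
    refine hm2.callOk ?_
    refine hih2.callOk ?_
    simp
    refine TabOk.intro (fun j => .real ((G * others (2 * h) j lv).coeff m)) 20 20
      (fun j hj => ?_) ⟨?_, ?_, ?_⟩
    · simp
      refine ⟨fun hj' => ⟨by omega, ?_⟩, fun hj' => ?_⟩
      · simp [show j - h < h by omega, hr j hj']
        congr 1
        ring
      · simp [hj', hl j hj']
        congr 1
        ring
    · rw [← two_mul]
      rfl
    · nlinarith
    · have h8 : 10000 * (k + 1 + 1) ^ 2 = 10000 * (k + 1) ^ 2 + 20000 * k + 30000 := by ring
      rw [h8]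
      generalize 10000 * (k + 1) ^ 2 = d at *
      omega

/-! ### Inversion of power series -/

theorem X_pow_dvd_sub_toPoly (n : ℕ) (p : ℝ[X]) : X ^ n ∣ p - toPoly n p.coeff := by
  rw [X_pow_dvd_iff]
  intro i hi
  rw [coeff_sub, coeff_toPoly, if_pos hi, sub_self]

/-- A Newton step squares the error `q * g - 1`, and the truncations of `q` and of the intermediate
products do not matter modulo `X ^ (2 * h)`. -/
theorem newton_step {h : ℕ} {q g : ℝ[X]} (hg : X ^ h ∣ q * g - 1) :
    X ^ (2 * h) ∣ q * toPoly (2 * h)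
      (2 * g - toPoly (2 * h) (toPoly (2 * h) q.coeff * g).coeff * g).coeff - 1 := by
  obtain ⟨a, ha⟩ := hg
  obtain ⟨b, hb⟩ := X_pow_dvd_sub_toPoly (2 * h) q
  obtain ⟨c, hc⟩ := X_pow_dvd_sub_toPoly (2 * h) (toPoly (2 * h) q.coeff * g)
  obtain ⟨d, hd⟩ := X_pow_dvd_sub_toPoly (2 * h)
    (2 * g - toPoly (2 * h) (toPoly (2 * h) q.coeff * g).coeff * g)
  refine ⟨-a ^ 2 + q * (b * g ^ 2 + c * g) - q * d, ?_⟩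
  linear_combination -(q * g - 1 + X ^ h * a) * ha + q * g ^ 2 * hb + q * g * hc - q * hd

set_option maxHeartbeats 1000000 in
theorem runs_inv {B l : ℕ} (k : ℕ) (hB : 4 * 2 ^ k + 10 ≤ B) (hl : 2 ^ k ≤ l) {q : ℝ[X]}
    (hq : q.coeff 0 = 1) :
    ∃ g : ℝ[X], g.natDegree < 2 ^ k ∧ X ^ 2 ^ k ∣ q * g - 1 ∧
      Runs prog B 9 (.pair (.nat (2 ^ k)) (parr l q)) (parr (2 ^ k) g) (20000 * 2 ^ k * (k + 1))
        (5000 * (k + 1) ^ 2) := by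
  induction k with
  | zero =>
    refine ⟨1, by simp, ?_, Runs.of_wp (body := invE) rfl ?_⟩
    · simp [X_dvd_iff, hq]
    · have h1 : 1 ≤ B := by omega
      have h2 : 2 ≤ B := by omega
      simp [invE, h1, h2]
      refine TabOk.intro (fun i => .real ((1 : ℝ[X]).coeff i)) 10 10 (fun i hi => ?_)
        ⟨rfl, by omega, by omega⟩
      rw [show i = 0 by omega]
      simp
  | succ k ih =>
    have hpow : 2 ^ (k + 1) = 2 * 2 ^ k := by ring
    have hpow2 : 2 ^ k + 2 ^ k + (2 ^ k + 2 ^ k) = 2 ^ (k + 2) := by ring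
    have hp : 1 ≤ 2 ^ k := Nat.one_le_two_pow
    obtain ⟨g, hg, hdvd, hrun⟩ := ih (by omega) (by omega)
    have hdeg : ∀ r : ℝ[X], (toPoly (2 * 2 ^ k) r.coeff).natDegree < 2 * 2 ^ k :=
      fun r => natDegree_toPoly_lt (by omega) _
    have hc1 := runs_conv (B := B) (k := k + 2) (la := 2 * 2 ^ k) (lb := 2 ^ k) (by omega)
      (hdeg q) hg (by omega)
    have hc2 := runs_conv (B := B) (k := k + 2) (la := 2 * 2 ^ k) (lb := 2 ^ k) (by omega)
      (hdeg (toPoly (2 * 2 ^ k) q.coeff * g)) hg (by omega)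
    refine ⟨toPoly (2 * 2 ^ k)
      (2 * g - toPoly (2 * 2 ^ k) (toPoly (2 * 2 ^ k) q.coeff * g).coeff * g).coeff, ?_, ?_,
      Runs.of_wp (body := invE) rfl ?_⟩
    · rw [hpow]
      exact hdeg _
    · rw [hpow]
      exact newton_step hdvd
    rw [← hpow2] at hc1 hc2
    rw [hpow] at hl hB ⊢
    have hg0 : ∀ i, 2 ^ k ≤ i → g.coeff i = 0 :=
      fun i hi => coeff_eq_zero_of_natDegree_lt (by omega)
    generalize 2 ^ k = h at *
    have hcoeff : ∀ (r : ℝ[X]) i, i < 2 * h → (toPoly (2 * h) r.coeff).coeff i = r.coeff i :=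
      fun r i hi => by rw [coeff_toPoly, if_pos hi]
    have hparr : ∀ r : ℝ[X], (farr (h + h) fun i => .real (r.coeff i)) =
        parr (2 * h) (toPoly (2 * h) r.coeff) := fun r => by
      rw [← two_mul]
      exact farr_congr fun i hi => by rw [hcoeff r i hi]
    have h1 : 1 ≤ B := by omega
    have h2 : 2 ≤ B := by omega
    have h4 : h ≤ B := by omega
    have h5 : h + h ≤ B := by omega
    have h6 : h + h + (h + h) ≤ B := by omega
    simp [invE, h1, h2, h4, h5, h6, show 0 < h by omega, show h ≠ 0 by omega]
    refine hrun.callOk ?_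
    refine TabOk.intro (fun i => .real (q.coeff i)) 10 10 (fun i hi => ?_) ?_
    · simp [show i < l by omega]
    rw [hparr]
    refine hc1.callOk ?_
    generalize toPoly (2 * h) q.coeff * g = e at *
    refine TabOk.intro (fun i => .real (e.coeff i)) 10 10 (fun i hi => ?_) ?_
    · simp [show i < h + h + (h + h) by omega]
    rw [hparr]
    refine hc2.callOk ?_
    generalize toPoly (2 * h) e.coeff * g = f at *
    refine TabOk.intro (fun i => .real ((2 * g - f).coeff i)) 20 20 (fun i hi => ?_) ⟨?_, ?_, ?_⟩
    · simp [show i < h + h + (h + h) by omega]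
      refine ⟨fun hi' => ?_, fun hi' => ?_⟩
      · simp [hg0 i hi']
      · simp [hi', two_mul]
    · exact hparr _
    · nlinarith
    · have h8 : 5000 * (k + 1 + 1) ^ 2 = 5000 * (k + 1) ^ 2 + 10000 * k + 15000 := by ring
      push_cast
      rw [h8]
      generalize 5000 * (k + 1) ^ 2 = d at *
      omega

/-! ### Recovering the weights -/

/-- The leaves `a i + b i * X`, followed by leaves `1`. -/
noncomputable def lin {m : ℕ} (a b : Fin m → ℝ) (i : ℕ) : ℝ[X] :=
  if h : i < m then C (a ⟨i, h⟩) + C (b ⟨i, h⟩) * X else 1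

theorem natDegree_lin_le {m : ℕ} (a b : Fin m → ℝ) (i : ℕ) : (lin a b i).natDegree ≤ 1 := by
  rw [lin]
  split_ifs
  · compute_degree
  · simp

theorem prod_range_eq_prod_fin {m n : ℕ} (hmn : m ≤ n) (f : ℕ → ℝ[X]) (hf : ∀ i, m ≤ i → f i = 1) :
    ∏ i ∈ Finset.range n, f i = ∏ i : Fin m, f i := by
  rw [Finset.prod_range fun i => f i, ← Finset.prod_range f, ← Finset.prod_range f]
  symm
  refine Finset.prod_subset (Finset.range_subset_range.2 hmn) fun i _ hi => hf i ?_
  simpa using hi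

theorem nodePoly_lin {m k : ℕ} (h : m ≤ 2 ^ k) (a b : Fin m → ℝ) :
    nodePoly k (lin a b) = ∏ i, (C (a i) + C (b i) * X) := by
  rw [nodePoly, prod_range_eq_prod_fin h _ fun i hi => by rw [lin, dif_neg (by omega)]]
  exact Finset.prod_congr rfl fun i _ => by rw [lin, dif_pos i.2]

theorem others_lin {m n : ℕ} (h : m ≤ n) (a b : Fin m → ℝ) (j : Fin m) :
    others n j (lin a b) = ∏ i ∈ Finset.univ.erase j, (C (a i) + C (b i) * X) := by
  rw [others, prod_range_eq_prod_fin h]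
  · rw [← Finset.mul_prod_erase _ _ (Finset.mem_univ j), if_pos rfl, one_mul]
    refine Finset.prod_congr rfl fun i hi => ?_
    rw [if_neg fun e => Finset.ne_of_mem_erase hi (Fin.ext e), lin, dif_pos i.2]
  · intro i hi
    rw [if_neg (by omega), lin, dif_neg (by omega)]

/-- The product of the differences of `p j` with the other parameters. -/
noncomputable def diffProd {m : ℕ} (p : Fin m → ℝ) (j : Fin m) : ℝ :=
  ∏ i ∈ Finset.univ.erase j, (p j - p i)

theorem diffProd_ne_zero {m : ℕ} {p : Fin m → ℝ} (hp : Function.Injective p) (j : Fin m) :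
    diffProd p j ≠ 0 :=
  Finset.prod_ne_zero_iff.2 fun _ hi => sub_ne_zero.2 fun e => Finset.ne_of_mem_erase hi (hp e).symm

/-- If `M` has the coefficients `∑ l, γ l * u l ^ i * v l ^ (N - i)`, then the coefficient of index
`N` of `M` times the product of the `a i + b i * X`, `i ≠ j`, is the combination, with coefficients
`γ l`, of the homogenised products evaluated at `(u l, v l)`. As the `i`-th linear form at
`(u l, v l)` is `p l - p i`, only the term `l = j` survives. The power of `X` moves the
coefficient to the index `n - 1` at which it appears in a product tree with `n - (N + 1)` further leaves `1`. -/
theorem coeff_mul_others {N n : ℕ} (hn : N + 1 ≤ n) {p a b u v γ : Fin (N + 1) → ℝ} {M : ℝ[X]}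
    (hM : ∀ i ≤ N, M.coeff i = ∑ l, γ l * (u l ^ i * v l ^ (N - i))) (hu : ∀ l, u l ≠ 0)
    (hlin : ∀ i l, a i * u l + b i * v l = p l - p i) (j : Fin (N + 1)) :
    (X ^ (n - (N + 1)) * M * others n j (lin a b)).coeff (n - 1) = γ j * diffProd p j := by
  have hidx : n - 1 = N + (n - (N + 1)) := by omega
  rw [mul_assoc, hidx, coeff_X_pow_mul, others_lin hn, mul_comm]
  have hcard : (Finset.univ.erase j).card = N := by simp
  have hdeg : (∏ i ∈ Finset.univ.erase j, (C (a i) + C (b i) * X)).natDegree ≤ N := by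
    refine (natDegree_prod_le _ _).trans ?_
    refine (Finset.sum_le_card_nsmul _ _ 1 fun i _ => ?_).trans (by simp [hcard])
    compute_degree
  have heval : ∀ l, u l ^ N * (∏ i ∈ Finset.univ.erase j, (C (a i) + C (b i) * X)).eval
      (v l / u l) = ∏ i ∈ Finset.univ.erase j, (p l - p i) := by
    intro l
    rw [eval_prod]
    have hpow : u l ^ N = ∏ _i ∈ Finset.univ.erase j, u l := by rw [Finset.prod_const, hcard]
    rw [hpow, ← Finset.prod_mul_distrib]
    refine Finset.prod_congr rfl fun i _ => ?_
    rw [← hlin i l]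
    have := hu l
    simp
    field_simp
  generalize ∏ i ∈ Finset.univ.erase j, (C (a i) + C (b i) * X) = F at *
  rw [coeff_mul_of_natDegree_le hdeg le_rfl]
  have hsum : ∑ i ∈ Finset.range (N + 1), F.coeff i * M.coeff (N - i) =
      ∑ l, γ l * ∏ i ∈ Finset.univ.erase j, (p l - p i) := by
    calc _ = ∑ i ∈ Finset.range (N + 1), ∑ l, γ l * (u l ^ N * (F.coeff i * (v l / u l) ^ i)) := by
          refine Finset.sum_congr rfl fun i hi => ?_
          have hi' : i ≤ N := Nat.lt_succ_iff.1 (Finset.mem_range.1 hi)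
          rw [hM _ (Nat.sub_le _ _), Finset.mul_sum]
          refine Finset.sum_congr rfl fun l _ => ?_
          have hul := hu l
          rw [Nat.sub_sub_self hi', ← Nat.sub_add_cancel hi', pow_add,
            Nat.sub_add_cancel hi', div_pow]
          field_simp
      _ = _ := by
          rw [Finset.sum_comm]
          refine Finset.sum_congr rfl fun l _ => ?_
          rw [← Finset.mul_sum, ← Finset.mul_sum, ← heval l,
            eval_eq_sum_range' (Nat.lt_succ_of_le hdeg)]
  rw [hsum, Finset.sum_eq_single j]
  · rfl
  · intro l _ hl
    rw [Finset.prod_eq_zero (Finset.mem_erase.2 ⟨hl, Finset.mem_univ l⟩) (sub_self _), mul_zero]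
  · simp

/-- The mixture moments: the entries of an induced vector divided by the binomial coefficients. -/
theorem Induces.div_choose {N : ℕ} {p α w : Fin (N + 1) → ℝ} (h : Induces N p α w)
    (i : Fin (N + 1)) :
    w i / (N.choose i : ℝ) = ∑ l, α l * (p l ^ (i : ℕ) * (1 - p l) ^ (N - i)) := by
  have hc : (N.choose i : ℝ) ≠ 0 :=
    Nat.cast_ne_zero.2 (Nat.choose_pos (Nat.lt_succ_iff.1 i.2)).ne'
  rw [h i, Finset.sum_div]
  refine Finset.sum_congr rfl fun l _ => ?_
  rw [bern]
  field_simp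

/-- The polynomial whose coefficients are the moments of a mixture. -/
noncomputable def momentPoly {N : ℕ} (w : Fin (N + 1) → ℝ) : ℝ[X] :=
  toPoly (N + 1) fun i => if h : i < N + 1 then w ⟨i, h⟩ / (N.choose i : ℝ) else 0

theorem coeff_num {N n : ℕ} (hn : N + 1 ≤ n) {p α w : Fin (N + 1) → ℝ} (hp : ∀ j, p j ≠ 0)
    (h : Induces N p α w) (j : Fin (N + 1)) :
    (X ^ (n - (N + 1)) * momentPoly w * others n j (lin (fun i => 1 - p i) fun i => -p i)).coeff
      (n - 1) = α j * diffProd p j := by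
  refine coeff_mul_others hn (u := p) (v := fun l => 1 - p l) (fun i hi => ?_) hp
    (fun i l => by ring) j
  rw [momentPoly, coeff_toPoly, if_pos (by omega), dif_pos (by omega)]
  exact h.div_choose ⟨i, by omega⟩

/-- The weights of a mixture with distinct nonzero parameters are determined by the induced
vector. -/
theorem Induces.unique {N : ℕ} {p α β w : Fin (N + 1) → ℝ} (hp : ∀ j, p j ≠ 0)
    (hinj : Function.Injective p) (hα : Induces N p α w) (hβ : Induces N p β w) : β = α := by
  funext j
  have h1 := coeff_num le_rfl hp hα j
  rw [coeff_num le_rfl hp hβ j] at h1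
  exact mul_right_cancel₀ (diffProd_ne_zero hinj j) h1

/-- The product of the `1 - p i * X`. -/
noncomputable def recPoly {m : ℕ} (p : Fin m → ℝ) : ℝ[X] := ∏ i, (C 1 + C (-p i) * X)

/-- The operator `m - X * d/dX` applied to a polynomial of degree at most `m`. -/
noncomputable def eulerPoly (m : ℕ) (q : ℝ[X]) : ℝ[X] :=
  toPoly m fun i => ((m - i : ℕ) : ℝ) * q.coeff i

theorem recPoly_coeff_zero {m : ℕ} (p : Fin m → ℝ) : (recPoly p).coeff 0 = 1 := by
  rw [coeff_zero_eq_eval_zero, recPoly, eval_prod]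
  simp

theorem natDegree_recPoly_le {m : ℕ} (p : Fin m → ℝ) : (recPoly p).natDegree ≤ m := by
  refine (natDegree_prod_le _ _).trans ?_
  refine (Finset.sum_le_card_nsmul _ _ 1 fun i _ => ?_).trans (by simp)
  compute_degree

theorem eulerPoly_recPoly {m : ℕ} (p : Fin m → ℝ) :
    eulerPoly m (recPoly p) = ∑ l, ∏ i ∈ Finset.univ.erase l, (C 1 + C (-p i) * X) := by
  have h1 : eulerPoly m (recPoly p) = C (m : ℝ) * recPoly p - X * derivative (recPoly p) := by
    ext i
    rw [eulerPoly, coeff_toPoly, coeff_sub, coeff_C_mul]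
    have hX : (X * derivative (recPoly p)).coeff i = i * (recPoly p).coeff i := by
      cases i with
      | zero => simp
      | succ i => rw [coeff_X_mul, coeff_derivative]; push_cast; ring
    rw [hX]
    split_ifs with hi
    · rw [Nat.cast_sub hi.le]
      ring
    · rcases (not_lt.1 hi).eq_or_lt with rfl | hi'
      · ring
      · rw [coeff_eq_zero_of_natDegree_lt ((natDegree_recPoly_le p).trans_lt hi')]
        ring
  have h2 : C (m : ℝ) * recPoly p = ∑ _l : Fin m, recPoly p := by simp
  rw [h1, h2, recPoly, derivative_prod_finset, Finset.mul_sum, ← Finset.sum_sub_distrib]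
  refine Finset.sum_congr rfl fun l _ => ?_
  rw [← Finset.mul_prod_erase _ _ (Finset.mem_univ l)]
  simp
  ring

/-- The generating function of the power sums of the parameters is the sum of the
`1 / (1 - p l * X)`, hence the quotient of `eulerPoly m (recPoly p)` by `recPoly p`. -/
theorem coeff_eulerPoly_mul {m n : ℕ} (hn : m ≤ n) {p : Fin m → ℝ} {g : ℝ[X]}
    (hg : X ^ n ∣ recPoly p * g - 1) {i : ℕ} (hi : i < m) :
    (eulerPoly m (recPoly p) * g).coeff i = ∑ l, p l ^ i := by
  have h1 : X ^ m ∣ recPoly p * toPoly m (fun i => ∑ l, p l ^ i) - eulerPoly m (recPoly p) := by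
    have hsum : toPoly m (fun i => ∑ l, p l ^ i) =
        ∑ l, ∑ i ∈ Finset.range m, (C (p l) * X) ^ i := by
      rw [toPoly, Finset.sum_comm]
      refine Finset.sum_congr rfl fun i _ => ?_
      simp only [map_sum, Finset.sum_mul, mul_pow, C_pow]
    rw [eulerPoly_recPoly, hsum, Finset.mul_sum, ← Finset.sum_sub_distrib]
    refine Finset.dvd_sum fun l _ => ?_
    rw [recPoly, ← Finset.mul_prod_erase _ _ (Finset.mem_univ l)]
    -- `(1 - p l * X) * ∑ i < m, (p l * X) ^ i = 1 - (p l * X) ^ m`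
    have hgeom := mul_neg_geom_sum (C (p l) * X) m
    refine ⟨-(C (p l) ^ m * ∏ i ∈ Finset.univ.erase l, (C 1 + C (-p i) * X)), ?_⟩
    rw [C_neg, C_1]
    linear_combination (∏ i ∈ Finset.univ.erase l, (1 + C (-p i) * X)) * hgeom
  have h2 : X ^ m ∣ eulerPoly m (recPoly p) * g - toPoly m (fun i => ∑ l, p l ^ i) := by
    obtain ⟨c, hc⟩ := h1
    obtain ⟨d, hd⟩ := (pow_dvd_pow X hn).trans hg
    exact ⟨toPoly m (fun i => ∑ l, p l ^ i) * d - c * g,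
      by linear_combination toPoly m (fun i => ∑ l, p l ^ i) * hd - g * hc⟩
  have h3 := X_pow_dvd_iff.1 h2 i hi
  rw [coeff_sub, coeff_toPoly, if_pos hi, sub_eq_zero] at h3
  exact h3

theorem coeff_den {N n : ℕ} (hn : N + 1 ≤ n) {p : Fin (N + 1) → ℝ} (hp : ∀ j, p j ≠ 0) {g : ℝ[X]}
    (hg : X ^ n ∣ recPoly p * g - 1) (j : Fin (N + 1)) :
    (X ^ (n - (N + 1)) * (eulerPoly (N + 1) (recPoly p) * g) *
      others n j (lin (fun _ => 1) fun i => -p i)).coeff (n - 1) = diffProd p j := by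
  rw [← one_mul (diffProd p j)]
  refine coeff_mul_others hn (γ := fun _ => 1) (u := p) (v := fun _ => 1) (fun i hi => ?_) hp
    (fun i l => by ring) j
  rw [coeff_eulerPoly_mul hn hg (by omega)]
  simp

theorem bernsteinMatrix_eq {N : ℕ} {p : Fin (N + 1) → ℝ} (hp : ∀ j, p j ≠ 1) :
    bernsteinMatrix N p = diagParam N p * Matrix.vandermonde (fun j => p j / (1 - p j)) *
      diagChoose N := by
  ext j i
  rw [diagParam, diagChoose, Matrix.mul_diagonal, Matrix.diagonal_mul, Matrix.vandermonde_apply,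
    bernsteinMatrix, Matrix.of_apply, bern, div_pow]
  have h1 : 1 - p j ≠ 0 := sub_ne_zero.2 (hp j).symm
  have h2 : (1 - p j) ^ N = (1 - p j) ^ (N - i) * (1 - p j) ^ (i : ℕ) := by
    rw [← pow_add, Nat.sub_add_cancel (Nat.lt_succ_iff.1 i.2)]
  rw [h2]
  field_simp

/-! ### Correctness and cost of the program -/

@[simp ↓] theorem asGet_encodeVec {n i : ℕ} {x : Fin n → ℝ} {k : Val → Prop} (h : i < n) :
    AsGet (encodeVec x) i k ↔ k (.real (x ⟨i, h⟩)) := by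
  simp [AsGet, encodeVec, h]

theorem runs_pow2 {B N K : ℕ} (hB : 4 * 2 ^ K + 10 ≤ B) (hN : N + 1 ≤ 2 ^ K)
    (hK : ∀ j < K, 2 ^ j < N + 1) (d j : ℕ) (hj : j + d = K) :
    Runs prog B 10 (.pair (.nat N) (.nat (2 ^ j))) (.nat (2 ^ K)) (50 * (d + 1))
      (50 * (d + 1)) := by
  have h1 : 1 ≤ B := by omega
  have h2 : N + 1 ≤ B := by omega
  induction d generalizing j with
  | zero =>
    obtain rfl : j = K := hj
    refine Runs.of_wp (body := pow2E) rfl ?_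
    simp [pow2E, h1, h2, hN, show ¬ 2 ^ j < N + 1 by omega]
  | succ d ih =>
    have hrun := ih (j + 1) (by omega)
    have h3 := hK j (by omega)
    have h4 : 2 ^ (j + 1) ≤ 2 ^ K := Nat.pow_le_pow_right (by norm_num) (by omega)
    rw [pow_succ, mul_two] at hrun h4
    refine Runs.of_wp (body := pow2E) rfl ?_
    simp [pow2E, h1, h2, h3, show ¬ N + 1 ≤ 2 ^ j by omega, show 2 ^ j + 2 ^ j ≤ B by omega]
    exact hrun.callOk ⟨rfl, by omega, by omega⟩

theorem lin_coeff_zero {m : ℕ} (a b : Fin m → ℝ) (i : ℕ) :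
    (lin a b i).coeff 0 = if h : i < m then a ⟨i, h⟩ else 1 := by
  rw [lin]
  split_ifs <;> simp

theorem lin_coeff_one {m : ℕ} (a b : Fin m → ℝ) (i : ℕ) :
    (lin a b i).coeff 1 = if h : i < m then b ⟨i, h⟩ else 0 := by
  rw [lin]
  split_ifs <;> simp [coeff_one, coeff_C]

theorem runs_num {B N K : ℕ} (hB : 4 * 2 ^ K + 10 ≤ B) (hN : N + 1 ≤ 2 ^ K)
    {p α w : Fin (N + 1) → ℝ} (hp : ∀ j, p j ≠ 0) (h : Induces N p α w) :
    ∃ f : ℕ → ℝ, (∀ j : Fin (N + 1), f j = α j * diffProd p j) ∧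
      Runs prog B 11 (.pair (.nat (2 ^ K)) (.pair (.nat N) (.pair (encodeVec p) (encodeVec w))))
        (farr (2 ^ K) fun j => .real (f j)) (100000 * 2 ^ K * (K + 1) ^ 2)
        (30000 * (K + 1) ^ 2) := by
  refine ⟨fun j => (X ^ (2 ^ K - (N + 1)) * momentPoly w * others (2 ^ K) j
    (lin (fun i => 1 - p i) fun i => -p i)).coeff (2 ^ K - 1), fun j => coeff_num hN hp h j, ?_⟩
  have hb1 := runs_build K hB (lin (fun _ : Fin N => 1) fun _ => 1) (natDegree_lin_le _ _)
  have hb2 := runs_build K hB (lin (fun i => 1 - p i) fun i => -p i) (natDegree_lin_le _ _)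
  have hd := runs_desc K 0 hB (lin (fun i => 1 - p i) fun i => -p i) (natDegree_lin_le _ _)
    (X ^ (2 ^ K - (N + 1)) * momentPoly w)
  have hchoose : ∀ i, (nodePoly K (lin (fun _ : Fin N => 1) fun _ => 1)).coeff i = N.choose i := by
    intro i
    rw [nodePoly_lin (by omega)]
    simp [coeff_one_add_X_pow]
  rw [tree] at hb1
  generalize nodePoly K (lin (fun _ : Fin N => 1) fun _ => 1) = q at *
  rw [zero_add, oarr] at hd
  refine Runs.of_wp (body := numE) rfl ?_
  have h1 : 1 ≤ B := by omega
  have h3 : N + 1 ≤ B := by omega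
  have hpos : 1 ≤ 2 ^ K := Nat.one_le_two_pow
  have hq : 2 ^ K ≤ 2 ^ K * (K + 1) ^ 2 := Nat.le_mul_of_pos_right _ (by positivity)
  have hsq : 1 ≤ (K + 1) ^ 2 := Nat.one_le_pow _ _ (by omega)
  generalize 2 ^ K = n at *
  simp [numE, h1, h3]
  refine TabOk.intro (fun i => .pair (.real ((lin (fun _ : Fin N => 1) (fun _ => 1) i).coeff 0))
    (.real ((lin (fun _ : Fin N => 1) (fun _ => 1) i).coeff 1))) 20 20 (fun i hi => ?_) ?_
  · rcases lt_or_ge i N with hi' | hi'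
    · simp [lin_coeff_zero, lin_coeff_one, hi']
    · simp [lin_coeff_zero, lin_coeff_one, hi']
  refine hb1.callOk ?_
  refine TabOk.intro (fun i => .pair (.real ((lin (fun i => 1 - p i) (fun i => -p i) i).coeff 0))
    (.real ((lin (fun i => 1 - p i) (fun i => -p i) i).coeff 1))) 40 40 (fun i hi => ?_) ?_
  · rcases lt_or_ge i (N + 1) with hi' | hi'
    · simp only [lin_coeff_zero, lin_coeff_one, dif_pos hi']
      simp [hi', show ¬ N < i by omega]
    · simp only [lin_coeff_zero, lin_coeff_one, dif_neg (show ¬ i < N + 1 by omega)]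
      simp [show ¬ i ≤ N by omega]
  refine hb2.callOk ?_
  refine TabOk.intro (fun i => .real ((X ^ (n - (N + 1)) * momentPoly w).coeff (0 + i))) 80 40
    (fun i hi => ?_) ?_
  · have h5 : i - (n - (N + 1)) < N + 1 := by omega
    have h7 : i - (n - (N + 1)) < n + 1 := by omega
    have h8 : (N.choose (i - (n - (N + 1))) : ℝ) ≠ 0 :=
      Nat.cast_ne_zero.2 (Nat.choose_pos (Nat.lt_succ_iff.1 h5)).ne'
    simp only [zero_add, coeff_X_pow_mul', momentPoly, coeff_toPoly, if_pos h5, dif_pos h5]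
    generalize hoff : n - (N + 1) = off at *
    have h9 : n ≤ B + (N + 1) := by omega
    have h10 : i ≤ B + off := by omega
    rcases lt_or_ge i off with hi' | hi'
    · simp [h9, hi', show ¬ n ≤ i + (N + 1) by omega, not_le.2 hi']
    · simp [h5, h7, h8, h9, h10, hi', not_lt.2 hi', hchoose, -Order.lt_add_one_iff]
  refine hd.callOk ⟨rfl, ?_, ?_⟩
  · nlinarith
  · omega

theorem runs_den {B N K : ℕ} (hB : 8 * 2 ^ K + 10 ≤ B) (hN : N + 1 ≤ 2 ^ K)
    {p : Fin (N + 1) → ℝ} (hp : ∀ j, p j ≠ 0) :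
    ∃ f : ℕ → ℝ, (∀ j : Fin (N + 1), f j = diffProd p j) ∧
      Runs prog B 12 (.pair (.nat (2 ^ K)) (.pair (.nat N) (encodeVec p)))
        (farr (2 ^ K) fun j => .real (f j)) (100000 * 2 ^ K * (K + 1) ^ 2)
        (30000 * (K + 1) ^ 2) := by
  have hnode : nodePoly K (lin (fun _ => 1) fun i => -p i) = recPoly p := nodePoly_lin hN _ _
  obtain ⟨g, hgdeg, hg, hinv⟩ := runs_inv (B := B) (l := 2 ^ K + 1) K (by omega) (by omega)
    (recPoly_coeff_zero p)
  refine ⟨fun j => (X ^ (2 ^ K - (N + 1)) * (eulerPoly (N + 1) (recPoly p) * g) *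
    others (2 ^ K) j (lin (fun _ => 1) fun i => -p i)).coeff (2 ^ K - 1),
    fun j => coeff_den hN hp hg j, ?_⟩
  have hb := runs_build K (by omega : 4 * 2 ^ K + 10 ≤ B) (lin (fun _ => 1) fun i => -p i)
    (natDegree_lin_le _ _)
  have hd := runs_desc K 0 (by omega : 4 * 2 ^ K + 10 ≤ B) (lin (fun _ => 1) fun i => -p i)
    (natDegree_lin_le _ _) (X ^ (2 ^ K - (N + 1)) * (eulerPoly (N + 1) (recPoly p) * g))
  have hc := runs_conv (B := B) (k := K + 1) (la := 2 ^ K) (lb := 2 ^ K)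
    (p := eulerPoly (N + 1) (recPoly p)) (by omega)
    ((natDegree_toPoly_lt (Nat.succ_pos N) _).trans_le hN) hgdeg (by omega)
  have hE : ∀ i, (eulerPoly (N + 1) (recPoly p)).coeff i =
      if i < N + 1 then ((N + 1 - i : ℕ) : ℝ) * (recPoly p).coeff i else 0 := coeff_toPoly _ _
  rw [tree, hnode] at hb hd
  rw [pow_succ, mul_two] at hc
  generalize recPoly p = q at *
  generalize eulerPoly (N + 1) q = e at *
  rw [zero_add, oarr] at hd
  refine Runs.of_wp (body := denE) rfl ?_
  have h1 : 1 ≤ B := by omega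
  have h3 : N + 1 ≤ B := by omega
  have hpos : 1 ≤ 2 ^ K := Nat.one_le_two_pow
  have hq : 2 ^ K ≤ 2 ^ K * (K + 1) ^ 2 := Nat.le_mul_of_pos_right _ (by positivity)
  have hsq : K + 1 ≤ (K + 1) ^ 2 := Nat.le_self_pow (by norm_num) _
  have hmul : 2 ^ K * (K + 1) ≤ 2 ^ K * (K + 1) ^ 2 := Nat.mul_le_mul_left _ hsq
  generalize 2 ^ K = n at *
  have h2 : n + n ≤ B := by omega
  simp [denE, h1, h2, h3]
  refine TabOk.intro (fun i => .pair (.real ((lin (fun _ => 1) (fun i => -p i) i).coeff 0))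
    (.real ((lin (fun _ => 1) (fun i => -p i) i).coeff 1))) 40 40 (fun i hi => ?_) ?_
  · rcases lt_or_ge i (N + 1) with hi' | hi'
    · simp only [lin_coeff_zero, lin_coeff_one, dif_pos hi']
      simp [hi', show ¬ N < i by omega]
    · simp only [lin_coeff_zero, lin_coeff_one, dif_neg (show ¬ i < N + 1 by omega)]
      simp [show ¬ i ≤ N by omega]
  refine hb.callOk ?_
  simp
  refine TabOk.intro (fun i => .real (e.coeff i)) 40 40 (fun i hi => ?_) ?_
  · rcases lt_or_ge i (N + 1) with hi' | hi'
    · rw [hE, if_pos hi']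
      simp [show ¬ N < i by omega, show i < n + 1 by omega, show N < B + i by omega]
    · rw [hE, if_neg (by omega)]
      simp [show ¬ i ≤ N by omega]
  refine hinv.callOk ?_
  refine hc.callOk ?_
  simp
  refine TabOk.intro (fun i => .real ((X ^ (n - (N + 1)) * (e * g)).coeff (0 + i))) 80 40
    (fun i hi => ?_) ?_
  · have h7 : i - (n - (N + 1)) < n + n := by omega
    simp only [zero_add, coeff_X_pow_mul']
    generalize hoff : n - (N + 1) = off at *
    have h9 : n ≤ B + (N + 1) := by omega
    have h10 : i ≤ B + off := by omega
    rcases lt_or_ge i off with hi' | hi'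
    · simp [h9, hi', show ¬ n ≤ i + (N + 1) by omega, not_le.2 hi']
    · simp [h7, h9, h10, hi', not_lt.2 hi', -Order.lt_add_one_iff]
  refine hd.callOk ⟨rfl, ?_, ?_⟩
  · nlinarith
  · omega

/-- The quotients of the two arrays are the weights, as the parameters are distinct. -/
theorem runs_main {B N K : ℕ} (hB : 8 * 2 ^ K + 10 ≤ B) (hN : N + 1 ≤ 2 ^ K)
    (hK : ∀ j < K, 2 ^ j < N + 1) {p α w : Fin (N + 1) → ℝ} (hp : ∀ j, p j ≠ 0)
    (hinj : Function.Injective p) (h : Induces N p α w) :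
    Runs prog B 0 (.pair (.nat N) (.pair (encodeVec p) (encodeVec w))) (encodeVec α)
      (300000 * 2 ^ K * (K + 1) ^ 2) (50000 * (K + 1) ^ 2) := by
  obtain ⟨f, hf, hnum⟩ := runs_num (by omega : 4 * 2 ^ K + 10 ≤ B) hN hp h
  obtain ⟨g, hg, hden⟩ := runs_den hB hN hp
  have hpow := runs_pow2 (B := B) (by omega) hN hK K 0 (zero_add K)
  rw [pow_zero] at hpow
  refine Runs.of_wp (body := mainE) rfl ?_
  have hq : 2 ^ K ≤ 2 ^ K * (K + 1) ^ 2 := Nat.le_mul_of_pos_right _ (by positivity)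
  have hpos : 1 ≤ 2 ^ K := Nat.one_le_two_pow
  have hsq : K + 1 ≤ (K + 1) ^ 2 := Nat.le_self_pow (by norm_num) _
  have hmul : 2 ^ K * (K + 1) ≤ 2 ^ K * (K + 1) ^ 2 := Nat.mul_le_mul_left _ hsq
  generalize 2 ^ K = n at *
  have h1 : 1 ≤ B := by omega
  have h3 : N + 1 ≤ B := by omega
  simp [mainE, h1, h3]
  refine hpow.callOk ?_
  refine hnum.callOk ?_
  refine hden.callOk ?_
  simp
  refine TabOk.intro (fun i => .real (if h : i < N + 1 then α ⟨i, h⟩ else 0)) 20 20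
    (fun i hi => ?_) ⟨?_, ?_, ?_⟩
  · have hfi := hf ⟨i, hi⟩
    have hgi := hg ⟨i, hi⟩
    have hne := diffProd_ne_zero hinj ⟨i, hi⟩
    simp only at hfi hgi
    simp only [dif_pos hi]
    simp [show i < n by omega, hfi, hgi, hne]
  · simp [farr, encodeVec]
  · nlinarith
  · omega

/-! ### Asymptotics -/

/-- The depth of the product tree with at least `N + 1` leaves. -/
def treeDepth (N : ℕ) : ℕ := Nat.clog 2 (N + 1)

theorem le_two_pow_treeDepth (N : ℕ) : N + 1 ≤ 2 ^ treeDepth N :=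
  Nat.le_pow_clog (by norm_num) _

theorem two_pow_lt_of_lt_treeDepth {N j : ℕ} (h : j < treeDepth N) : 2 ^ j < N + 1 :=
  Nat.pow_lt_of_lt_clog h

theorem two_pow_treeDepth_le {N : ℕ} (hN : 1 ≤ N) : 2 ^ treeDepth N ≤ 2 * N := by
  have h0 : 0 < treeDepth N := Nat.clog_pos (by norm_num) (by omega)
  have h1 := two_pow_lt_of_lt_treeDepth (Nat.sub_lt h0 one_pos)
  have h2 : 2 ^ treeDepth N = 2 ^ (treeDepth N - 1) * 2 := by
    rw [← pow_succ, Nat.sub_add_cancel h0]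
  omega

theorem treeDepth_add_one_le {N : ℕ} (hN : 3 ≤ N) : (treeDepth N + 1 : ℝ) ≤ 5 * Real.log N := by
  have hN0 : (0 : ℝ) < N := by positivity
  have h1 : (2 : ℝ) ^ treeDepth N ≤ 2 * N := by exact_mod_cast two_pow_treeDepth_le (by omega)
  have h2 : treeDepth N * Real.log 2 ≤ Real.log 2 + Real.log N := by
    rw [← Real.log_pow, ← Real.log_mul (by norm_num) hN0.ne']
    exact Real.log_le_log (by positivity) h1
  have h3 : 1 ≤ Real.log N := by
    rw [Real.le_log_iff_exp_le hN0]
    have : (3 : ℝ) ≤ N := by exact_mod_cast hN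
    linarith [Real.exp_one_lt_d9]
  have h4 := Real.log_two_gt_d9
  have h5 := Real.log_two_lt_d9
  nlinarith

theorem isBigO_work :
    (fun N : ℕ => ((300000 * 2 ^ treeDepth N * (treeDepth N + 1) ^ 2 : ℕ) : ℝ)) =O[Filter.atTop]
      fun N : ℕ => (N : ℝ) * Real.log N ^ 2 := by
  refine Asymptotics.IsBigO.of_bound 15000000 ?_
  filter_upwards [Filter.eventually_ge_atTop 3] with N hN
  have h1 : (2 : ℝ) ^ treeDepth N ≤ 2 * N := by exact_mod_cast two_pow_treeDepth_le (by omega)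
  have h2 : ((treeDepth N : ℝ) + 1) ^ 2 ≤ (5 * Real.log N) ^ 2 :=
    pow_le_pow_left₀ (by positivity) (treeDepth_add_one_le hN) 2
  rw [Real.norm_of_nonneg (by positivity), Real.norm_of_nonneg (by positivity)]
  push_cast
  calc (300000 : ℝ) * 2 ^ treeDepth N * (treeDepth N + 1) ^ 2
      ≤ 300000 * (2 * N) * (5 * Real.log N) ^ 2 := by gcongr
    _ = 15000000 * (N * Real.log N ^ 2) := by ring

theorem isBigO_depth :
    (fun N : ℕ => ((50000 * (treeDepth N + 1) ^ 2 : ℕ) : ℝ)) =O[Filter.atTop]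
      fun N : ℕ => Real.log N ^ 2 := by
  refine Asymptotics.IsBigO.of_bound 1250000 ?_
  filter_upwards [Filter.eventually_ge_atTop 3] with N hN
  have h2 : ((treeDepth N : ℝ) + 1) ^ 2 ≤ (5 * Real.log N) ^ 2 :=
    pow_le_pow_left₀ (by positivity) (treeDepth_add_one_le hN) 2
  rw [Real.norm_of_nonneg (by positivity), Real.norm_of_nonneg (by positivity)]
  push_cast
  linarith

/-- All integers that occur are below `16 * N + 10`. -/
theorem wordBound {N : ℕ} (hN : 1 ≤ N) : 8 * 2 ^ treeDepth N + 10 ≤ (N + 2) ^ 5 := by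
  have h1 := two_pow_treeDepth_le hN
  have h2 : 3 ^ 4 * (N + 2) ≤ (N + 2) ^ 5 := by
    rw [pow_succ (N + 2) 4]
    exact Nat.mul_le_mul_right _ (Nat.pow_le_pow_left (by omega) 4)
  omega

end

end MDBD

theorem mainTheorem6 :
    (∀ (N : ℕ), 1 ≤ N → ∀ (p α what : Fin (N + 1) → ℝ),
      MDBD.IsMixture p α → MDBD.Induces N p α what →
        MDBD.bernsteinMatrix N p =
            MDBD.diagParam N p * Matrix.vandermonde (fun j => p j / (1 - p j)) *
              MDBD.diagChoose N ∧
          ∀ β : Fin (N + 1) → ℝ, MDBD.Induces N p β what → β = α) ∧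
    ∃ (P : MDBD.Program) (k c : ℕ) (W D : ℕ → ℕ),
      1 ≤ c ∧
      (fun N : ℕ => (W N : ℝ)) =O[Filter.atTop] (fun N : ℕ => (N : ℝ) * Real.log N ^ 2) ∧
      (fun N : ℕ => (D N : ℝ)) =O[Filter.atTop] (fun N : ℕ => Real.log N ^ c) ∧
      ∀ (N : ℕ), 1 ≤ N → ∀ (p α what : Fin (N + 1) → ℝ),
        MDBD.IsMixture p α → MDBD.Induces N p α what →
          P.Computes ((N + 2) ^ k)
            (.pair (.nat N) (.pair (MDBD.encodeVec p) (MDBD.encodeVec what)))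
            (MDBD.encodeVec α) (W N) (D N) := by
  refine ⟨fun N _ p α w hmix hind => ⟨?_, fun β hβ => ?_⟩, MDBD.prog, 5, 2,
    fun N => 300000 * 2 ^ MDBD.treeDepth N * (MDBD.treeDepth N + 1) ^ 2,
    fun N => 50000 * (MDBD.treeDepth N + 1) ^ 2, by norm_num, MDBD.isBigO_work,
    MDBD.isBigO_depth, fun N hN p α w hmix hind => ?_⟩
  · exact MDBD.bernsteinMatrix_eq fun j => (hmix.param_mem j).2.ne
  · exact hind.unique (fun j => (hmix.param_mem j).1.ne') hmix.distinct hβ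
  · obtain ⟨body, hbody, w', d', he, hw, hd⟩ := MDBD.runs_main (MDBD.wordBound hN)
      (MDBD.le_two_pow_treeDepth N) (fun j => MDBD.two_pow_lt_of_lt_treeDepth)
      (fun j => (hmix.param_mem j).1.ne') hmix.distinct hind
    exact ⟨body, w', d', hbody, he, hw, hd⟩
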